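/- Let $n\ge 1$, $0<p<\infty$. Let $|\cdot|$ be the Euclidean norm on $\mathbb C^n$, $\mathbb B^n(0,r)=\{z\in\mathbb C^n:|z|<r\}$, $\mathbb B^n=\mathbb B^n(0,1)$, and let $\sigma$ be the normalized surface measure on $\partial\mathbb B^n$. The Hardy space $H^p$ consists of the holomorphic maps $f:\mathbb B^n\to\mathbb C^n$ with $$\|f\|_p=\sup_{0<r<1}\left\{\int_{\partial\mathbb B^n}|f(r\zeta)|^p\,d\sigma(\zeta)\right\}^{1/p}<+\infty,$$ and $f'=(\partial f_i/\partial z_j)_{n\times n}$ is the complex Jacobian matrix. Suppose that $f\in H^p$ satisfies $\|f\|_p\le K_0$ for some constant $K_0>0$, $f(0)=0$ and $|\det f'(0)|=\lambda_0>0$, where $K_0\ge\lambda_0$. Put $$m=\frac{\sqrt2\,(7+\sqrt{17})}{4\sqrt{5-\sqrt{17}}}\approx 4.1996,\qquad \rho_1(r)=\frac{\lambda_0}{mK_0^n}\,r^{n+1}(1-r^2)^{n^2/p}\quad(0<r<1),\qquad r_0=\sqrt{\frac{p(n+1)}{p(n+1)+2n^2}}.$$ Then $0<r_0<1$, $\rho_1(r_0)=\max_{0<r<1}\rho_1(r)$,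 $\mathbb B^n(0,\rho_1(r_0))\subset\mathbb B^n$, and $f$ is univalent (holomorphic and injective) in $\mathbb B^n(0,\rho_1(r_0))$. Moreover, the range $f(\mathbb B^n(0,\rho_1(r_0)))$ contains a univalent ball $\mathbb B^n(0,R)$, that is, $f$ maps some open subset of $\mathbb B^n(0,\rho_1(r_0))$ containing $0$ biholomorphically onto $\mathbb B^n(0,R)$, where $$R=\frac{\lambda_0^2}{2mK_0^{2n-1}}\left(\frac{p(n+1)}{p(n+1)+2n^2}\right)^{n}\left(\frac{2n^2}{p(n+1)+2n^2}\right)^{\frac{2n^2-n}{p}}.$$ -/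

import Mathlib

open Metric MeasureTheory Set
open scoped ENNReal

noncomputable section

/-- The space `ℂⁿ` with its Hermitian (Euclidean) norm. -/
abbrev Cn (n : ℕ) : Type := EuclideanSpace ℂ (Fin n)

/-- The normalized surface measure on the unit sphere of `ℂⁿ`. -/
def sphereMeasure (n : ℕ) : Measure (sphere (0 : Cn n) 1) :=
  ((volume : Measure (Cn n)).toSphere univ)⁻¹ • (volume : Measure (Cn n)).toSphere

/-- `‖f‖_p = sup_{0<r<1} (∫ |f(rζ)|^p dσ(ζ))^{1/p}`, with values in `[0, ∞]`. -/
def hardyNorm {n : ℕ} (p : ℝ) (f : Cn n → Cn n) : ℝ≥0∞ :=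
  ⨆ r ∈ Ioo (0 : ℝ) 1,
    (∫⁻ ζ : sphere (0 : Cn n) 1, ‖f ((r : ℂ) • (ζ : Cn n))‖ₑ ^ p ∂(sphereMeasure n)) ^ (1 / p)

/-- The Hardy space `H^p` of holomorphic maps of the unit ball of `ℂⁿ` into `ℂⁿ`. -/
def MemHardy {n : ℕ} (p : ℝ) (f : Cn n → Cn n) : Prop :=
  DifferentiableOn ℂ f (ball 0 1) ∧ hardyNorm p f < ∞

/-- The complex Jacobian matrix `(∂f_i/∂z_j)` of `f` at `z`. -/
def complexJacobian {n : ℕ} (f : Cn n → Cn n) (z : Cn n) : Matrix (Fin n) (Fin n) ℂ :=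
  Matrix.of fun i j => (fderiv ℂ f z (EuclideanSpace.single j 1)) i

/-- `f` is univalent (holomorphic and injective) in the set `U`. -/
def UnivalentOn {n : ℕ} (f : Cn n → Cn n) (U : Set (Cn n)) : Prop :=
  DifferentiableOn ℂ f U ∧ InjOn f U

/-- `f` maps the open set `U` biholomorphically onto the open set `V`. -/
def BiholomorphicOn {n : ℕ} (f : Cn n → Cn n) (U V : Set (Cn n)) : Prop :=
  IsOpen U ∧ IsOpen V ∧ DifferentiableOn ℂ f U ∧ BijOn f U V ∧
    ∃ g : Cn n → Cn n, DifferentiableOn ℂ g V ∧ InvOn g f U V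

/-- The ball with center `f a` and radius `R` is a univalent (schlicht) ball of `f` centered at
`f a` and contained in the range `f(U)`: it is the biholomorphic image under `f` of an open
subset of `U` that contains `a`. -/
def ContainsUnivalentBall {n : ℕ} (f : Cn n → Cn n) (U : Set (Cn n)) (a : Cn n) (R : ℝ) : Prop :=
  ∃ W ⊆ U, a ∈ W ∧ BiholomorphicOn f W (ball (f a) R)

/-- The constant `m = √2 (7 + √17) / (4 √(5 - √17))`. -/
def landauM : ℝ := √2 * (7 + √17) / (4 * √(5 - √17))

/-- `ρ₁(r) = λ₀ / (m K₀ⁿ) · r^{n+1} (1 - r²)^{n²/p}`. -/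
def rhoOne (n : ℕ) (p K₀ lam₀ r : ℝ) : ℝ :=
  lam₀ / (landauM * K₀ ^ n) * (r ^ (n + 1) * (1 - r ^ 2) ^ ((n : ℝ) ^ 2 / p))

/-- `r₀ = √(p(n+1) / (p(n+1) + 2n²))`. -/
def rZero (n : ℕ) (p : ℝ) : ℝ :=
  √(p * (n + 1) / (p * (n + 1) + 2 * (n : ℝ) ^ 2))

/-- The radius
`R = λ₀² / (2 m K₀^{2n-1}) · (p(n+1)/(p(n+1)+2n²))ⁿ · (2n²/(p(n+1)+2n²))^{(2n²-n)/p}`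
of the univalent ball (used for `n ≥ 1` only, so that `2n - 1` is not truncated). -/
def landauR (n : ℕ) (p K₀ lam₀ : ℝ) : ℝ :=
  lam₀ ^ 2 / (2 * landauM * K₀ ^ (2 * n - 1)) *
    (p * (n + 1) / (p * (n + 1) + 2 * (n : ℝ) ^ 2)) ^ n *
    (2 * (n : ℝ) ^ 2 / (p * (n + 1) + 2 * (n : ℝ) ^ 2)) ^ ((2 * (n : ℝ) ^ 2 - n) / p)

end

/-!
The theorem combines a growth estimate for Hardy maps with a Landau theorem for bounded maps.

**Growth.** If `‖f‖_p ≤ K`, then `‖f z‖ ≤ K (1 - ‖z‖ ^ 2) ^ (-n / p)` (`norm_le_of_hardyNorm_le`).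
Instead of changing variables on the sphere, the proof integrates over the ball against the weights
`(1 - ‖z‖ ^ 2) ^ β` with `-1 < β ≤ 0` and lets `β → -1`. In polar coordinates the weighted integral
of `‖f‖ ^ p` is at most `K ^ p` times the integral of the weight. An automorphism of the ball taking
`0` to `z` (`ballShift`) turns it into the weighted integral of `‖G‖ ^ p`, where `G` is `f` composed
with the automorphism and multiplied by a holomorphic power of its Jacobian. Averaging over the
circles `θ ↦ exp (i θ) w` and the subharmonicity of `‖G‖ ^ p` bound that integral below by
`‖G 0‖ ^ p` times the integral of the weight, and `G 0` is a multiple of `f z`. Subharmonicity for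
every `p > 0` comes from Jensen's formula for `log ‖g‖` followed by Jensen's inequality for `exp`.

**Landau's theorem for bounded maps.** Let `F` map the unit ball to its closure, with `F 0 = 0` and
`|det F'(0)| = α`. Then `‖F'(z)‖ ≤ 1 / (1 - ‖z‖ ^ 2)` by the Schwarz–Pick lemma on slices, and the
Schwarz lemma for `F' - F'(0)` on a ball of radius `s` gives
`‖F'(z) - F'(0)‖ ≤ (1 / (1 - s ^ 2) + 1) / s * ‖z‖`, whose constant is minimal, and equal to
`landauM`, for `s ^ 2 = (5 - √17) / 2`. Since `F'(0)` is a contraction, `‖F'(0) v‖ ≥ α ‖v‖`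
(`norm_det_mul_norm_le`). A map with `‖f'(z) - f'(0)‖ ≤ c ‖z‖` and `‖f'(0) v‖ ≥ a ‖v‖` is injective
on the ball of radius `a / c` by the mean value inequality, and its image contains a univalent ball
of radius `a ^ 2 / (2 c)` (`containsUnivalentBall_of_fderiv_sub_le`).

The theorem is the case of `f` on the ball of radius `r = rZero n p`, with the bound
`M = K₀ (1 - r ^ 2) ^ (-n / p)` from the growth estimate. That `rZero n p` maximizes `rhoOne` is the
weighted arithmetic-geometric mean inequality.
-/

/-! ### Subharmonicity of powers of the norm -/

open Real in
/-- Jensen's formula bounds `log ‖g 0‖` by the mean of `log ‖g‖` on the unit circle, and Jensen's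
inequality for `exp` turns this into a bound for `‖g 0‖ ^ p`. -/
theorem norm_rpow_le_circleAverage {g : ℂ → ℂ} (hg : AnalyticOnNhd ℂ g (closedBall 0 1)) {p : ℝ}
    (hp : 0 < p) : ‖g 0‖ ^ p ≤ circleAverage (fun z => ‖g z‖ ^ p) 0 1 := by
  rcases eq_or_ne (g 0) 0 with h0 | h0
  · rw [h0, norm_zero, zero_rpow hp.ne']
    exact circleAverage_nonneg_of_nonneg fun z _ => by positivity
  have hg' : AnalyticOnNhd ℂ g (closedBall 0 |1|) := by simpa using hg
  have hlog : log ‖g 0‖ ≤ circleAverage (log ‖g ·‖) 0 1 := by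
    rw [hg'.circleAverage_log_norm one_ne_zero h0]
    refine le_add_of_nonneg_left (finsum_nonneg fun u => ?_)
    by_cases hu : u ∈ closedBall (0 : ℂ) |1|
    · refine mul_nonneg ?_ ?_
      · exact_mod_cast (MeromorphicOn.AnalyticOnNhd.divisor_nonneg hg') u
      · rcases eq_or_ne u 0 with rfl | hu0
        · simp
        · refine log_nonneg ?_
          rw [one_mul, zero_sub, norm_neg]
          exact (one_le_inv₀ (by positivity)).2 (by simpa using hu)
    · simp [Function.locallyFinsuppWithin.apply_eq_zero_of_notMem _ hu]
  have hci : CircleIntegrable (fun z => log ‖g z‖) 0 1 :=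
    (hg'.mono sphere_subset_closedBall).meromorphicOn.circleIntegrable_log_norm
  have hcont : ContinuousOn (fun z => ‖g z‖ ^ p) (sphere 0 1) :=
    ((hg.continuousOn.mono sphere_subset_closedBall).norm).rpow_const fun _ _ => Or.inr hp.le
  have hci2 : CircleIntegrable (fun z => ‖g z‖ ^ p) 0 1 := hcont.circleIntegrable zero_le_one
  -- `exp (p * log ‖g z‖)` and `‖g z‖ ^ p` differ at the zeros of `g`, a discrete set
  have hcod : (fun z => ‖g z‖ ^ p) =ᶠ[Filter.codiscreteWithin (sphere (0 : ℂ) |1|)]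
      fun z => exp (p * log ‖g z‖) := by
    have h := hg'.preimage_zero_mem_codiscreteWithin h0 (by simp)
      ((convex_closedBall (0 : ℂ) |1|).isConnected ⟨0, by simp⟩)
    filter_upwards [Filter.codiscreteWithin_mono sphere_subset_closedBall h] with z hz
    have hz : g z ≠ 0 := by simpa using hz
    rw [rpow_def_of_pos (norm_pos_iff.2 hz), mul_comm]
  rw [circleAverage_congr_codiscreteWithin hcod one_ne_zero]
  set c := p * log ‖g 0‖ with hc
  have hci3 : CircleIntegrable (fun z => exp c * p * log ‖g z‖) 0 1 := by
    simpa using hci.const_fun_smul (a := exp c * p)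
  have hlin : circleAverage (fun z => exp c * p * log ‖g z‖ + exp c * (1 - c)) 0 1 =
      exp c * p * circleAverage (log ‖g ·‖) 0 1 + exp c * (1 - c) := by
    rw [circleAverage_fun_add hci3 (circleIntegrable_const _ _ _), circleAverage_const]
    congr 1
    simpa using circleAverage_fun_smul (a := exp c * p) (f := fun z => log ‖g z‖) (c := 0) (R := 1)
  have hmono : circleAverage (fun z => exp c * p * log ‖g z‖ + exp c * (1 - c)) 0 1 ≤
      circleAverage (fun z => exp (p * log ‖g z‖)) 0 1 := by
    refine circleAverage_mono (hci3.add (circleIntegrable_const _ _ _))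
      (hci2.congr_codiscreteWithin hcod) fun z _ => ?_
    have h1 := add_one_le_exp (p * log ‖g z‖ - c)
    have h2 : exp (p * log ‖g z‖) = exp c * exp (p * log ‖g z‖ - c) := by
      rw [← exp_add]; congr 1; ring
    rw [h2]
    nlinarith [exp_pos c]
  have h0c : ‖g 0‖ ^ p = exp c := by
    rw [rpow_def_of_pos (norm_pos_iff.2 h0), mul_comm]
  rw [h0c]
  refine le_trans ?_ (hlin ▸ hmono)
  have := mul_le_mul_of_nonneg_left hlog (mul_pos (exp_pos c) hp).le
  nlinarith [exp_pos c]

open Real in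
/-- Sub-mean value property of `‖g‖ ^ p` for a vector-valued holomorphic `g`, which reduces to the
scalar case by a norming functional of `g 0`. -/
theorem two_pi_mul_enorm_rpow_le_lintegral {E : Type*} [NormedAddCommGroup E] [NormedSpace ℂ E]
    {g : ℂ → E} {R : ℝ} (hR : 1 < R) (hg : DifferentiableOn ℂ g (ball 0 R)) {p : ℝ} (hp : 0 < p) :
    ENNReal.ofReal (2 * π) * ‖g 0‖ₑ ^ p ≤
      ∫⁻ θ in Ioc 0 (2 * π), ‖g (circleMap 0 1 θ)‖ₑ ^ p := by
  rcases eq_or_ne (g 0) 0 with h0 | h0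
  · simp [h0, hp]
  obtain ⟨L, hL, hL0⟩ := exists_dual_vector ℂ (g 0) (norm_ne_zero_iff.2 h0)
  have hLg : AnalyticOnNhd ℂ (fun z => L (g z)) (closedBall 0 1) :=
    ((L.differentiable.comp_differentiableOn hg).analyticOnNhd isOpen_ball).mono
      (closedBall_subset_ball hR)
  have hle := norm_rpow_le_circleAverage hLg hp
  have hnn : ∀ z, 0 ≤ ‖L (g z)‖ ^ p := fun z => by positivity
  have hcont : ContinuousOn (fun z => ‖L (g z)‖ ^ p) (sphere 0 1) :=
    ((hLg.continuousOn.mono sphere_subset_closedBall).norm).rpow_const fun _ _ => Or.inr hp.le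
  have hci : CircleIntegrable (fun z => ‖L (g z)‖ ^ p) 0 1 := hcont.circleIntegrable zero_le_one
  rw [circleAverage_def, smul_eq_mul, hL0, RCLike.norm_ofReal, abs_norm,
    le_inv_mul_iff₀ (by positivity), intervalIntegral.integral_of_le (by positivity)] at hle
  calc ENNReal.ofReal (2 * π) * ‖g 0‖ₑ ^ p
      = ENNReal.ofReal (2 * π * ‖g 0‖ ^ p) := by
        rw [ENNReal.ofReal_mul (p := 2 * π) (by positivity),
          ← ENNReal.ofReal_rpow_of_nonneg (norm_nonneg _) hp.le, ofReal_norm]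
    _ ≤ ENNReal.ofReal (∫ θ in Ioc 0 (2 * π), ‖L (g (circleMap 0 1 θ))‖ ^ p) :=
        ENNReal.ofReal_le_ofReal hle
    _ = ∫⁻ θ in Ioc 0 (2 * π), ENNReal.ofReal (‖L (g (circleMap 0 1 θ))‖ ^ p) := by
        refine ofReal_integral_eq_lintegral_ofReal ?_ (Filter.Eventually.of_forall fun θ => hnn _)
        exact (intervalIntegrable_iff_integrableOn_Ioc_of_le (by positivity)).1 hci
    _ ≤ ∫⁻ θ in Ioc 0 (2 * π), ‖g (circleMap 0 1 θ)‖ₑ ^ p := by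
        refine lintegral_mono fun θ => ?_
        rw [← ENNReal.ofReal_rpow_of_nonneg (norm_nonneg _) hp.le, ofReal_norm]
        refine ENNReal.rpow_le_rpow ?_ hp.le
        have := L.le_of_opNorm_le hL.le (g (circleMap 0 1 θ))
        rw [one_mul] at this
        exact enorm_le_iff_norm_le.2 this

/-! ### Radial weights on the ball -/

theorem measurable_enorm_rpow_indicator_ball {n : ℕ} {f : Cn n → Cn n}
    (hf : ContinuousOn f (ball 0 1)) (p : ℝ) :
    Measurable ((ball (0 : Cn n) 1).indicator fun z => ‖f z‖ₑ ^ p) := by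
  classical
  have h : Measurable ((ball (0 : Cn n) 1).piecewise f fun _ => 0) :=
    hf.measurable_piecewise continuousOn_const isOpen_ball.measurableSet
  have h2 := (h.enorm.pow_const p).indicator (isOpen_ball (x := (0 : Cn n)) (ε := 1)).measurableSet
  convert h2 using 1
  ext z
  by_cases hz : z ∈ ball (0 : Cn n) 1 <;> simp only [indicator, piecewise, hz, if_true, if_false]

/-- Polar coordinates in `ℂⁿ`. -/
theorem lintegral_mul_comp_norm_eq {n : ℕ} (hn : 1 ≤ n) {h : Cn n → ℝ≥0∞} (hh : Measurable h)
    {W : ℝ → ℝ≥0∞} (hW : Measurable W) :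
    ∫⁻ z, h z * W ‖z‖ =
      ∫⁻ r : Ioi (0 : ℝ), (∫⁻ ζ : sphere (0 : Cn n) 1, h ((r : ℝ) • (ζ : Cn n))
        ∂(volume : Measure (Cn n)).toSphere) * W r
        ∂(Measure.volumeIoiPow (Module.finrank ℝ (Cn n) - 1)) := by
  have : Nonempty (Fin n) := ⟨⟨0, hn⟩⟩
  have hmp := (volume : Measure (Cn n)).measurePreserving_homeomorphUnitSphereProd
  set F : sphere (0 : Cn n) 1 × Ioi (0 : ℝ) → ℝ≥0∞ :=
    fun x => h ((x.2 : ℝ) • (x.1 : Cn n)) * W x.2 with hF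
  have hFm : Measurable F := by
    refine (hh.comp ?_).mul (hW.comp (by fun_prop))
    have : Continuous fun x : sphere (0 : Cn n) 1 × Ioi (0 : ℝ) => (x.2 : ℝ) • (x.1 : Cn n) := by
      fun_prop
    exact this.measurable
  calc ∫⁻ z, h z * W ‖z‖ = ∫⁻ z in ({0}ᶜ : Set (Cn n)), h z * W ‖z‖ := by
        rw [restrict_compl_singleton]
    _ = ∫⁻ z : ({0}ᶜ : Set (Cn n)), h z * W ‖(z : Cn n)‖ ∂(volume.comap Subtype.val) :=
        (lintegral_subtype_comap (measurableSet_singleton _).compl _).symm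
    _ = ∫⁻ z : ({0}ᶜ : Set (Cn n)), F (homeomorphUnitSphereProd (Cn n) z)
          ∂(volume.comap Subtype.val) := by
        refine lintegral_congr fun z => ?_
        have hz : ‖(z : Cn n)‖ ≠ 0 := norm_ne_zero_iff.2 z.2
        simp [hF, smul_smul, hz]
    _ = ∫⁻ x, F x ∂((volume : Measure (Cn n)).toSphere.prod
          (Measure.volumeIoiPow (Module.finrank ℝ (Cn n) - 1))) := hmp.lintegral_comp hFm
    _ = _ := by
        rw [lintegral_prod_symm' _ hFm]
        refine lintegral_congr fun r => ?_
        simp only [hF]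
        rw [lintegral_mul_const]
        exact hh.comp (by fun_prop)

/-- The weighted integral of `‖f‖ ^ p` over the ball is at most `‖f‖_p ^ p` times that of `1`. -/
theorem lintegral_ball_le_hardyNorm {n : ℕ} (hn : 1 ≤ n) {p : ℝ} (hp : 0 < p) {f : Cn n → Cn n}
    (hf : ContinuousOn f (ball 0 1)) (hfin : hardyNorm p f ≠ ∞) {W : ℝ → ℝ≥0∞}
    (hW : Measurable W) :
    ∫⁻ z in ball (0 : Cn n) 1, ‖f z‖ₑ ^ p * W ‖z‖ ≤
      hardyNorm p f ^ p * ∫⁻ z in ball (0 : Cn n) 1, W ‖z‖ := by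
  have : Nonempty (Fin n) := ⟨⟨0, hn⟩⟩
  set τ := (volume : Measure (Cn n)).toSphere with hτ
  have hτ0 : τ univ ≠ 0 := by
    rw [Ne, Measure.measure_univ_eq_zero]; exact Measure.toSphere_ne_zero _
  have hτt : τ univ ≠ ∞ := measure_ne_top _ _
  have hms : MeasurableSet (ball (0 : Cn n) 1) := isOpen_ball.measurableSet
  have hind : ∀ u : Cn n → ℝ≥0∞, ∫⁻ z in ball (0 : Cn n) 1, u z * W ‖z‖ =
      ∫⁻ z, (ball (0 : Cn n) 1).indicator u z * W ‖z‖ := by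
    intro u
    rw [← lintegral_indicator hms]
    refine lintegral_congr fun z => ?_
    by_cases hz : z ∈ ball (0 : Cn n) 1 <;> simp [hz]
  have h1 := hind fun _ => 1
  simp only [one_mul] at h1
  rw [hind, h1, lintegral_mul_comp_norm_eq hn (measurable_enorm_rpow_indicator_ball hf p) hW,
    lintegral_mul_comp_norm_eq hn (measurable_const.indicator hms) hW]
  rw [← lintegral_const_mul']
  · refine lintegral_mono fun r => ?_
    rw [← mul_assoc]
    refine mul_le_mul_left ?_ _
    have hr0 : (0 : ℝ) < r := r.2
    have hmem : ∀ ζ : sphere (0 : Cn n) 1,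
        ((r : ℝ) • (ζ : Cn n) ∈ ball (0 : Cn n) 1 ↔ (r : ℝ) < 1) := by
      intro ζ
      rw [mem_ball_zero_iff, norm_smul, norm_eq_of_mem_sphere, mul_one, Real.norm_of_nonneg hr0.le]
    by_cases hr : (r : ℝ) < 1
    · simp only [indicator_of_mem ((hmem _).2 hr), lintegral_const, one_mul]
      have hle : (∫⁻ ζ : sphere (0 : Cn n) 1, ‖f (((r : ℝ) : ℂ) • (ζ : Cn n))‖ₑ ^ p
          ∂(sphereMeasure n)) ^ (1 / p) ≤ hardyNorm p f :=
        le_iSup₂_of_le (r : ℝ) ⟨hr0, hr⟩ le_rfl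
      rw [one_div, ENNReal.rpow_inv_le_iff hp, sphereMeasure, lintegral_smul_measure, smul_eq_mul,
        ENNReal.inv_mul_le_iff hτ0 hτt] at hle
      simp only [Complex.coe_smul] at hle
      rw [mul_comm (hardyNorm p f ^ p)]
      exact hle
    · have : ∀ ζ : sphere (0 : Cn n) 1, (r : ℝ) • (ζ : Cn n) ∉ ball (0 : Cn n) 1 :=
        fun ζ => mt (hmem ζ).1 hr
      simp [indicator_of_notMem (this _)]
  · exact ENNReal.rpow_ne_top_of_nonneg hp.le hfin

theorem measurePreserving_smul_of_norm_eq_one {n : ℕ} {c : ℂ} (hc : ‖c‖ = 1) :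
    MeasurePreserving (fun z : Cn n => c • z) :=
  let e : Cn n ≃ₗᵢ[ℝ] Cn n :=
    { (LinearEquiv.smulOfNeZero ℂ (Cn n) c
        (norm_ne_zero_iff.1 (by rw [hc]; exact one_ne_zero))).restrictScalars ℝ with
      norm_map' := fun z => by
        change ‖c • z‖ = ‖z‖
        rw [norm_smul, hc, one_mul] }
  e.measurePreserving

open Real in
theorem two_pi_mul_enorm_rpow_le_lintegral_smul {n : ℕ} {p : ℝ} (hp : 0 < p) {G : Cn n → Cn n}
    (hG : DifferentiableOn ℂ G (ball 0 1)) {z : Cn n} (hz : z ∈ ball (0 : Cn n) 1) :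
    ENNReal.ofReal (2 * π) * ‖G 0‖ₑ ^ p ≤
      ∫⁻ θ in Ioc 0 (2 * π), ‖G (circleMap 0 1 θ • z)‖ₑ ^ p := by
  have hz1 : ‖z‖ < 1 := mem_ball_zero_iff.1 hz
  obtain ⟨R, hR1, hR⟩ : ∃ R : ℝ, 1 < R ∧ R * ‖z‖ < 1 := by
    refine ⟨2 / (1 + ‖z‖), ?_, ?_⟩
    · rw [lt_div_iff₀ (by positivity)]; linarith
    · rw [div_mul_eq_mul_div, div_lt_one (by positivity)]; linarith
  have hmaps : MapsTo (fun ζ : ℂ => ζ • z) (ball 0 R) (ball 0 1) := by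
    intro ζ hζ
    rw [mem_ball_zero_iff] at hζ ⊢
    rw [norm_smul]
    exact (mul_le_mul_of_nonneg_right hζ.le (norm_nonneg _)).trans_lt hR
  have hd : DifferentiableOn ℂ (fun ζ : ℂ => G (ζ • z)) (ball 0 R) :=
    hG.comp (by fun_prop) hmaps
  simpa only [zero_smul] using two_pi_mul_enorm_rpow_le_lintegral hR1 hd hp

open Real in
/-- Sub-mean value property of `‖G‖ ^ p` at the origin against a radial weight: average the
one-variable inequality over the circles `θ ↦ exp (i θ) w`. -/
theorem enorm_rpow_mul_lintegral_le {n : ℕ} {p : ℝ} (hp : 0 < p) {G : Cn n → Cn n}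
    (hG : DifferentiableOn ℂ G (ball 0 1)) {W : ℝ → ℝ≥0∞} (hW : Measurable W) :
    ‖G 0‖ₑ ^ p * ∫⁻ z in ball (0 : Cn n) 1, W ‖z‖ ≤
      ∫⁻ z in ball (0 : Cn n) 1, ‖G z‖ₑ ^ p * W ‖z‖ := by
  have hms : MeasurableSet (ball (0 : Cn n) 1) := isOpen_ball.measurableSet
  set u : Cn n → ℝ≥0∞ := (ball (0 : Cn n) 1).indicator fun z => ‖G z‖ₑ ^ p with hu
  have hum : Measurable u := measurable_enorm_rpow_indicator_ball hG.continuousOn p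
  have hWm : Measurable fun z : Cn n => W ‖z‖ := hW.comp measurable_norm
  have hind : ∫⁻ z in ball (0 : Cn n) 1, ‖G z‖ₑ ^ p * W ‖z‖ = ∫⁻ z, u z * W ‖z‖ := by
    rw [← lintegral_indicator hms]
    refine lintegral_congr fun z => ?_
    by_cases hz : z ∈ ball (0 : Cn n) 1 <;> simp [hz, hu]
  have hcm : ∀ θ, ‖circleMap 0 1 θ‖ = 1 := fun θ => by simp
  have hrot : ∀ θ : ℝ, ∫⁻ z, u (circleMap 0 1 θ • z) * W ‖z‖ = ∫⁻ z, u z * W ‖z‖ := by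
    intro θ
    have hm : Measurable fun z => u z * W ‖z‖ := hum.mul hWm
    have h := (measurePreserving_smul_of_norm_eq_one (n := n) (hcm θ)).lintegral_comp hm
    simpa only [norm_smul, hcm, one_mul] using h
  have hcirc : ∀ z ∈ ball (0 : Cn n) 1, ENNReal.ofReal (2 * π) * ‖G 0‖ₑ ^ p ≤
      ∫⁻ θ in Ioc 0 (2 * π), u (circleMap 0 1 θ • z) := by
    intro z hz
    have hu' : ∀ θ, u (circleMap 0 1 θ • z) = ‖G (circleMap 0 1 θ • z)‖ₑ ^ p := fun θ => by
      rw [hu, indicator_of_mem]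
      rw [mem_ball_zero_iff, norm_smul, hcm, one_mul]
      exact mem_ball_zero_iff.1 hz
    simp only [hu']
    exact two_pi_mul_enorm_rpow_le_lintegral_smul hp hG hz
  have h2π : ENNReal.ofReal (2 * π) ≠ 0 := by
    rw [Ne, ENNReal.ofReal_eq_zero, not_le]; positivity
  have hum2 : Continuous fun x : Cn n × ℝ => circleMap 0 1 x.2 • x.1 := by fun_prop
  rw [hind, ← ENNReal.mul_le_mul_iff_right h2π ENNReal.ofReal_ne_top]
  calc ENNReal.ofReal (2 * π) * (‖G 0‖ₑ ^ p * ∫⁻ z in ball (0 : Cn n) 1, W ‖z‖)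
      = ∫⁻ z in ball (0 : Cn n) 1, ENNReal.ofReal (2 * π) * ‖G 0‖ₑ ^ p * W ‖z‖ := by
        rw [lintegral_const_mul _ hWm, mul_assoc]
    _ ≤ ∫⁻ z in ball (0 : Cn n) 1,
          (∫⁻ θ in Ioc 0 (2 * π), u (circleMap 0 1 θ • z)) * W ‖z‖ :=
        setLIntegral_mono' hms fun z hz => mul_le_mul_left (hcirc z hz) _
    _ ≤ ∫⁻ z, (∫⁻ θ in Ioc 0 (2 * π), u (circleMap 0 1 θ • z)) * W ‖z‖ :=
        setLIntegral_le_lintegral _ _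
    _ = ∫⁻ z, ∫⁻ θ in Ioc 0 (2 * π), u (circleMap 0 1 θ • z) * W ‖z‖ := by
        refine lintegral_congr fun z => ?_
        have hc : Continuous fun θ : ℝ => circleMap 0 1 θ • z := by fun_prop
        exact (lintegral_mul_const _ (hum.comp hc.measurable)).symm
    _ = ∫⁻ θ in Ioc 0 (2 * π), ∫⁻ z, u (circleMap 0 1 θ • z) * W ‖z‖ := by
        have hm : Measurable fun x : Cn n × ℝ => u (circleMap 0 1 x.2 • x.1) * W ‖x.1‖ :=
          (hum.comp hum2.measurable).mul (hWm.comp measurable_fst)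
        exact lintegral_lintegral_swap (f := fun z θ => u (circleMap 0 1 θ • z) * W ‖z‖)
          hm.aemeasurable
    _ = ENNReal.ofReal (2 * π) * ∫⁻ z, u z * W ‖z‖ := by
        simp only [hrot, lintegral_const]
        rw [mul_comm]; simp

/-! ### The weights `(1 - ‖z‖ ^ 2) ^ β` -/

theorem one_sub_sq_rpow_le {x β : ℝ} (hβ : β ≤ 0) (hx0 : 0 ≤ x) (hx1 : x < 1) :
    (1 - x ^ 2) ^ β ≤ (1 - x) ^ β :=
  Real.rpow_le_rpow_of_nonpos (by linarith) (by nlinarith) hβ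

theorem one_le_one_sub_sq_rpow {x β : ℝ} (hβ : β ≤ 0) (hx0 : 0 ≤ x) (hx1 : x < 1) :
    1 ≤ (1 - x ^ 2) ^ β :=
  Real.one_le_rpow_of_pos_of_le_one_of_nonpos (by nlinarith) (by nlinarith) hβ

theorem integrableOn_one_sub_norm_sq_rpow {n : ℕ} (hn : 1 ≤ n) {β : ℝ} (hβ : -1 < β) (hβ0 : β ≤ 0) :
    IntegrableOn (fun z : Cn n => (1 - ‖z‖ ^ 2) ^ β) (ball 0 1) := by
  have : Nonempty (Fin n) := ⟨⟨0, hn⟩⟩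
  refine (integrableOn_fun_norm_addHaar (μ := (volume : Measure (Cn n)))
    (f := fun x : ℝ => (1 - x ^ 2) ^ β)).2 ?_
  have h1 : IntegrableOn (fun x : ℝ => (1 - x) ^ β) (Ioo 0 1) := by
    have h := ((intervalIntegral.intervalIntegrable_rpow' (a := 0) (b := 1) hβ).comp_sub_left 1).symm
    simp only [sub_zero, sub_self] at h
    exact (intervalIntegrable_iff_integrableOn_Ioo_of_le zero_le_one).1 h
  refine h1.mono' (by fun_prop) ?_
  filter_upwards [ae_restrict_mem measurableSet_Ioo] with x hx
  have h0 : 0 ≤ (1 - x ^ 2) ^ β := Real.rpow_nonneg (by nlinarith [hx.1, hx.2]) _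
  rw [smul_eq_mul, Real.norm_of_nonneg (mul_nonneg (pow_nonneg hx.1.le _) h0)]
  exact (mul_le_of_le_one_left h0 (pow_le_one₀ hx.1.le hx.2.le)).trans
    (one_sub_sq_rpow_le hβ0 hx.1.le hx.2)

theorem lintegral_one_sub_norm_sq_rpow_ne_top {n : ℕ} (hn : 1 ≤ n) {β : ℝ} (hβ : -1 < β)
    (hβ0 : β ≤ 0) :
    ∫⁻ z in ball (0 : Cn n) 1, ENNReal.ofReal ((1 - ‖z‖ ^ 2) ^ β) ≠ ∞ :=
  (integrableOn_one_sub_norm_sq_rpow hn hβ hβ0).lintegral_lt_top.ne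

theorem lintegral_one_sub_norm_sq_rpow_ne_zero {n : ℕ} {β : ℝ} (hβ0 : β ≤ 0) :
    ∫⁻ z in ball (0 : Cn n) 1, ENNReal.ofReal ((1 - ‖z‖ ^ 2) ^ β) ≠ 0 := by
  refine ((measure_ball_pos volume (0 : Cn n) one_pos).trans_le ?_).ne'
  rw [← setLIntegral_one]
  refine setLIntegral_mono' isOpen_ball.measurableSet fun z hz => ?_
  rw [ENNReal.one_le_ofReal]
  exact one_le_one_sub_sq_rpow hβ0 (norm_nonneg _) (mem_ball_zero_iff.1 hz)

/-! ### Automorphisms of the ball -/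

/-- For a unit vector `e` and `s ^ 2 = 1 - t ^ 2`, the automorphism of the unit ball that takes `0`
to `t e`. In an orthonormal basis whose first vector is `e` it reads
`(w₁, w') ↦ ((t + w₁) / (1 + t w₁), s w' / (1 + t w₁))`. -/
noncomputable def ballShift {n : ℕ} (e : Cn n) (t s : ℝ) (w : Cn n) : Cn n :=
  (1 + t * inner ℂ e w)⁻¹ • ((t + (1 - s) * inner ℂ e w) • e + (s : ℂ) • w)

theorem one_add_inner_re_pos {n : ℕ} {e w : Cn n} {t : ℝ} (he : ‖e‖ = 1) (ht0 : 0 ≤ t)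
    (ht1 : t < 1) (hw : w ∈ ball (0 : Cn n) 1) : 0 < (1 + t * inner ℂ e w).re := by
  have h1 : |(inner ℂ e w).re| ≤ ‖w‖ := by
    refine (Complex.abs_re_le_norm _).trans ((norm_inner_le_norm e w).trans_eq ?_)
    rw [he, one_mul]
  have hw1 : ‖w‖ < 1 := mem_ball_zero_iff.1 hw
  simp only [Complex.add_re, Complex.one_re, Complex.re_ofReal_mul]
  nlinarith [abs_le.1 h1, neg_abs_le (inner ℂ e w).re]

theorem one_add_inner_ne_zero {n : ℕ} {e w : Cn n} {t : ℝ} (he : ‖e‖ = 1) (ht0 : 0 ≤ t)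
    (ht1 : t < 1) (hw : w ∈ ball (0 : Cn n) 1) : (1 + t * inner ℂ e w : ℂ) ≠ 0 := fun h => by
  have := one_add_inner_re_pos he ht0 ht1 hw
  rw [h] at this
  simp at this

theorem inner_ballShift {n : ℕ} {e w : Cn n} {t s : ℝ} (he : ‖e‖ = 1) :
    inner ℂ e (ballShift e t s w) = (1 + t * inner ℂ e w)⁻¹ * (t + inner ℂ e w) := by
  rw [ballShift, inner_smul_right, inner_add_right, inner_smul_right, inner_smul_right,
    inner_self_eq_norm_sq_to_K, he]
  push_cast
  ring

theorem ballShift_zero {n : ℕ} (e : Cn n) (t s : ℝ) : ballShift e t s 0 = (t : ℂ) • e := by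
  simp [ballShift]

theorem one_sub_norm_ballShift_sq {n : ℕ} {e w : Cn n} {t s : ℝ} (he : ‖e‖ = 1)
    (hs : s ^ 2 = 1 - t ^ 2) (h0 : (1 + t * inner ℂ e w : ℂ) ≠ 0) :
    1 - ‖ballShift e t s w‖ ^ 2 = ‖(s / (1 + t * inner ℂ e w) : ℂ)‖ ^ 2 * (1 - ‖w‖ ^ 2) := by
  have hN : ‖1 + t * inner ℂ e w‖ ^ 2 - ‖(t + (1 - s) * inner ℂ e w) • e + (s : ℂ) • w‖ ^ 2 =
      s ^ 2 * (1 - ‖w‖ ^ 2) := by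
    rw [norm_add_sq (𝕜 := ℂ) (_ • e), norm_smul, norm_smul, he, mul_one, inner_smul_left,
      inner_smul_right, mul_pow, Complex.norm_real, Real.norm_eq_abs, sq_abs]
    generalize inner ℂ e w = ω
    rw [Complex.sq_norm, Complex.sq_norm, Complex.normSq_apply, Complex.normSq_apply]
    simp
    linear_combination (ω.re ^ 2 + ω.im ^ 2 - 1) * hs
  have hpos : 0 < ‖1 + t * inner ℂ e w‖ := norm_pos_iff.2 h0
  rw [ballShift, norm_smul, norm_inv, norm_div, mul_pow, div_pow, Complex.norm_real,
    Real.norm_eq_abs, sq_abs]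
  generalize ‖(t + (1 - s) * inner ℂ e w) • e + (s : ℂ) • w‖ = N at hN ⊢
  field_simp
  linear_combination hN

theorem mapsTo_ballShift {n : ℕ} {e : Cn n} {t s : ℝ} (he : ‖e‖ = 1) (ht0 : 0 ≤ t)
    (ht1 : t < 1) (hs : s ^ 2 = 1 - t ^ 2) : MapsTo (ballShift e t s) (ball 0 1) (ball 0 1) := by
  intro w hw
  have h0 := one_add_inner_ne_zero he ht0 ht1 hw
  have hs0 : (s : ℂ) ≠ 0 := by
    rintro h
    rw [Complex.ofReal_eq_zero] at h
    rw [h] at hs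
    nlinarith
  have h := one_sub_norm_ballShift_sq he hs h0
  have hw1 : ‖w‖ < 1 := mem_ball_zero_iff.1 hw
  have h1 : 0 < ‖(s / (1 + t * inner ℂ e w) : ℂ)‖ ^ 2 * (1 - ‖w‖ ^ 2) :=
    mul_pos (pow_pos (norm_pos_iff.2 (div_ne_zero hs0 h0)) 2) (by nlinarith [norm_nonneg w])
  rw [mem_ball_zero_iff]
  nlinarith [norm_nonneg (ballShift e t s w)]

theorem injOn_ballShift {n : ℕ} {e : Cn n} {t s : ℝ} (he : ‖e‖ = 1) (ht0 : 0 ≤ t)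
    (ht1 : t < 1) (hs : s ^ 2 = 1 - t ^ 2) : InjOn (ballShift e t s) (ball 0 1) := by
  intro w hw v hv hwv
  have hw0 := one_add_inner_ne_zero he ht0 ht1 hw
  have hv0 := one_add_inner_ne_zero he ht0 ht1 hv
  have hst : s ^ 2 ≠ 0 := by nlinarith
  have hs0 : (s : ℂ) ≠ 0 := by
    rw [Ne, Complex.ofReal_eq_zero]
    rintro rfl
    simp at hst
  have h1 := congrArg (inner ℂ e) hwv
  rw [inner_ballShift he, inner_ballShift he] at h1
  have hinner : inner ℂ e w = inner ℂ e v := by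
    have h2 : ((s ^ 2 : ℝ) : ℂ) * (inner ℂ e w - inner ℂ e v) = 0 := by
      rw [hs]
      field_simp at h1
      push_cast
      linear_combination h1
    exact sub_eq_zero.1 ((mul_eq_zero.1 h2).resolve_left (Complex.ofReal_ne_zero.2 hst))
  rw [ballShift, ballShift, hinner] at hwv
  have h3 := smul_right_injective (Cn n) (inv_ne_zero hv0) hwv
  exact smul_right_injective (Cn n) hs0 (add_left_cancel h3)

/-- The derivative of `ballShift` is a rank one perturbation of a homothety, so its determinant
can be read off from that of a transvection. -/
theorem exists_hasFDerivAt_ballShift {n : ℕ} {e w : Cn n} {t s : ℝ} (he : ‖e‖ = 1)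
    (hs : s ^ 2 = 1 - t ^ 2) (hs0 : s ≠ 0) (h0 : (1 + t * inner ℂ e w : ℂ) ≠ 0) :
    ∃ D : Cn n →L[ℂ] Cn n, HasFDerivAt (ballShift e t s) D w ∧
      LinearMap.det (D : Cn n →ₗ[ℂ] Cn n) = (s / (1 + t * inner ℂ e w)) ^ (n + 1) := by
  have hsc : (s : ℂ) ≠ 0 := Complex.ofReal_ne_zero.2 hs0
  have hscc : (s : ℂ) ^ 2 = 1 - t ^ 2 := by exact_mod_cast hs
  have hω : HasFDerivAt (fun w : Cn n => (inner ℂ e w : ℂ)) (innerSL ℂ e) w :=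
    (innerSL ℂ e).hasFDerivAt
  have hden : HasFDerivAt (fun w : Cn n => (1 + t * inner ℂ e w : ℂ)) ((t : ℂ) • innerSL ℂ e) w :=
    (hω.const_mul (t : ℂ)).const_add 1
  have hnum : HasFDerivAt (fun w : Cn n => (t + (1 - s) * inner ℂ e w : ℂ) • e + (s : ℂ) • w)
      ((((1 - s : ℂ) • innerSL ℂ e).smulRight e) + (s : ℂ) • ContinuousLinearMap.id ℂ (Cn n)) w :=
    (((hω.const_mul (1 - s : ℂ)).const_add (t : ℂ)).smul_const e).add
      ((hasFDerivAt_id w).const_smul (s : ℂ))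
  have hinv := (hasDerivAt_inv h0).comp_hasFDerivAt w hden
  have hD := hinv.smul hnum
  refine ⟨_, hD, ?_⟩
  set c : ℂ := 1 + t * inner ℂ e w with hc
  set N : Cn n := (t + (1 - s) * inner ℂ e w : ℂ) • e + (s : ℂ) • w with hN
  have heN : inner ℂ e N = t + inner ℂ e w := by
    rw [hN, inner_add_right, inner_smul_right, inner_smul_right,
      inner_self_eq_norm_sq_to_K, he]
    push_cast
    ring
  have hlin : ∀ M : Cn n →ₗ[ℂ] Cn n, M = (s / c) • LinearMap.transvection
      ((innerSL ℂ e : Cn n →L[ℂ] ℂ) : Cn n →ₗ[ℂ] ℂ)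
      ((c / s) • ((c⁻¹ * (1 - s)) • e - ((c ^ 2)⁻¹ * t) • N)) →
      LinearMap.det M = (s / c) ^ (n + 1) := by
    rintro M rfl
    rw [LinearMap.det_smul, LinearMap.transvection.det, finrank_euclideanSpace_fin]
    simp only [ContinuousLinearMap.coe_coe, innerSL_apply_apply]
    rw [inner_smul_right, inner_sub_right, inner_smul_right, inner_smul_right, heN,
      inner_self_eq_norm_sq_to_K, he, pow_succ]
    congr 1
    push_cast
    field_simp
    rw [hc, hscc]
    ring
  apply hlin
  ext1 v
  simp only [LinearMap.transvection.apply, LinearMap.smul_apply, ContinuousLinearMap.coe_coe,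
    add_apply, smul_apply,
    ContinuousLinearMap.smulRight_apply, innerSL_apply_apply, ContinuousLinearMap.id_apply,
    Function.comp_apply, smul_eq_mul]
  rw [← hc]
  clear_value c N
  match_scalars <;> field_simp

/-! ### Growth of Hardy maps -/

theorem differentiableOn_ballShift {n : ℕ} {e : Cn n} {t s : ℝ} (he : ‖e‖ = 1) (ht0 : 0 ≤ t)
    (ht1 : t < 1) (hs : s ^ 2 = 1 - t ^ 2) (hs0 : s ≠ 0) :
    DifferentiableOn ℂ (ballShift e t s) (ball 0 1) := fun w hw => by
  obtain ⟨D, hD, -⟩ := exists_hasFDerivAt_ballShift (w := w) he hs hs0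
    (one_add_inner_ne_zero he ht0 ht1 hw)
  exact hD.differentiableAt.differentiableWithinAt

/-- Change of variables under `ballShift`. The complex Jacobian is
`(s / (1 + t ⟪e, w⟫)) ^ (n + 1)`, and the real one is the square of its modulus. -/
theorem lintegral_comp_ballShift_le {n : ℕ} {e : Cn n} {t s : ℝ} (he : ‖e‖ = 1) (ht0 : 0 ≤ t)
    (ht1 : t < 1) (hs : s ^ 2 = 1 - t ^ 2) (hs0 : s ≠ 0) (u : Cn n → ℝ≥0∞) :
    ∫⁻ w in ball (0 : Cn n) 1,
        ENNReal.ofReal ((‖(s / (1 + t * inner ℂ e w) : ℂ)‖ ^ 2) ^ (n + 1)) * u (ballShift e t s w) ≤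
      ∫⁻ z in ball (0 : Cn n) 1, u z := by
  have hex : ∀ w : Cn n, ∃ D : Cn n →L[ℂ] Cn n, w ∈ ball (0 : Cn n) 1 →
      (HasFDerivAt (ballShift e t s) D w ∧
      LinearMap.det (D : Cn n →ₗ[ℂ] Cn n) = (s / (1 + t * inner ℂ e w)) ^ (n + 1)) := by
    intro w
    by_cases hw : w ∈ ball (0 : Cn n) 1
    · obtain ⟨D, hD⟩ := exists_hasFDerivAt_ballShift (w := w) he hs hs0
        (one_add_inner_ne_zero he ht0 ht1 hw)
      exact ⟨D, fun _ => hD⟩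
    · exact ⟨0, fun h => absurd h hw⟩
  choose D hD using hex
  have hdet : ∀ w ∈ ball (0 : Cn n) 1, |((D w).restrictScalars ℝ).det| =
      (‖(s / (1 + t * inner ℂ e w) : ℂ)‖ ^ 2) ^ (n + 1) := by
    intro w hw
    have h := LinearMap.det_restrictScalars (R := ℝ) (f := (D w : Cn n →ₗ[ℂ] Cn n))
    rw [(hD w hw).2, Algebra.norm_complex_apply, Complex.normSq_eq_norm_sq, norm_pow,
      pow_right_comm] at h
    change |LinearMap.det ((D w : Cn n →ₗ[ℂ] Cn n).restrictScalars ℝ)| = _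
    rw [h, abs_of_nonneg (by positivity)]
  have hcv := lintegral_image_eq_lintegral_abs_det_fderiv_mul (volume : Measure (Cn n))
    (isOpen_ball (x := (0 : Cn n)) (ε := 1)).measurableSet
    (fun w hw => ((hD w hw).1.restrictScalars ℝ).hasFDerivWithinAt)
    (injOn_ballShift he ht0 ht1 hs) u
  refine le_trans (le_of_eq ?_) (lintegral_mono_set (mapsTo_ballShift he ht0 ht1 hs).image_subset)
  rw [hcv]
  refine setLIntegral_congr_fun isOpen_ball.measurableSet fun w hw => ?_
  simp only [hdet w hw]

/-- The pointwise bound for Hardy maps before the limit `β → -1` of the weights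
`(1 - ‖z‖ ^ 2) ^ β`: the map `f ∘ ballShift`, multiplied by a power of the Jacobian, satisfies the
sub-mean value property at `0`. -/
theorem rpow_mul_norm_rpow_le_of_weight {n : ℕ} (hn : 1 ≤ n) {p : ℝ} (hp : 0 < p) {f : Cn n → Cn n}
    (hf : DifferentiableOn ℂ f (ball 0 1)) {K : ℝ} (hK : 0 ≤ K)
    (hfK : hardyNorm p f ≤ ENNReal.ofReal K) {e : Cn n} {t : ℝ} (he : ‖e‖ = 1) (ht0 : 0 ≤ t)
    (ht1 : t < 1) {β : ℝ} (hβ : -1 < β) (hβ0 : β ≤ 0) :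
    (1 - t ^ 2) ^ (n + 1 + β) * ‖f ((t : ℂ) • e)‖ ^ p ≤ K ^ p := by
  set s : ℝ := √(1 - t ^ 2) with hsdef
  have hspos : 0 < s := Real.sqrt_pos.2 (by nlinarith)
  have hs : s ^ 2 = 1 - t ^ 2 := Real.sq_sqrt (by nlinarith)
  set γ : ℝ := 2 * (n + 1 + β) / p with hγ
  have hγp : γ * p = 2 * (n + 1 + β) := div_mul_cancel₀ _ hp.ne'
  set G : Cn n → Cn n := fun w =>
    ((s ^ γ : ℝ) : ℂ) • ((1 + t * inner ℂ e w : ℂ) ^ ((-γ : ℝ) : ℂ)) • f (ballShift e t s w) with hG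
  have hslit : ∀ w ∈ ball (0 : Cn n) 1, (1 + t * inner ℂ e w : ℂ) ∈ Complex.slitPlane :=
    fun w hw => Or.inl (one_add_inner_re_pos he ht0 ht1 hw)
  have hGd : DifferentiableOn ℂ G (ball 0 1) := by
    have hd : DifferentiableOn ℂ (fun w : Cn n => (1 + t * inner ℂ e w : ℂ)) (ball 0 1) :=
      (((innerSL ℂ e).differentiable.differentiableOn).const_mul (t : ℂ)).const_add 1
    have hpow : DifferentiableOn ℂ (fun w : Cn n => (1 + t * inner ℂ e w : ℂ) ^ ((-γ : ℝ) : ℂ))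
        (ball 0 1) := hd.cpow (differentiableOn_const _) hslit
    have hcomp : DifferentiableOn ℂ (fun w => f (ballShift e t s w)) (ball 0 1) :=
      hf.comp (differentiableOn_ballShift he ht0 ht1 hs hspos.ne') (mapsTo_ballShift he ht0 ht1 hs)
    exact (hpow.smul hcomp).const_smul ((s ^ γ : ℝ) : ℂ)
  have hGn : ∀ w ∈ ball (0 : Cn n) 1, ‖G w‖ =
      ‖(s / (1 + t * inner ℂ e w) : ℂ)‖ ^ γ * ‖f (ballShift e t s w)‖ := by
    intro w hw
    simp only [hG]
    rw [norm_smul, norm_smul, Complex.norm_real, Complex.norm_cpow_real, norm_div, Complex.norm_real,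
      Real.norm_of_nonneg (Real.rpow_nonneg hspos.le _), Real.norm_of_nonneg hspos.le,
      Real.div_rpow hspos.le (norm_nonneg _), Real.rpow_neg (norm_nonneg _), ← mul_assoc,
      div_eq_mul_inv]
  set W : ℝ → ℝ≥0∞ := fun r => ENNReal.ofReal ((1 - r ^ 2) ^ β) with hW
  have hWm : Measurable W := by fun_prop
  set J : ℝ≥0∞ := ∫⁻ z in ball (0 : Cn n) 1, W ‖z‖ with hJ
  have hkey : ‖G 0‖ₑ ^ p * J ≤ ENNReal.ofReal K ^ p * J := by
    calc ‖G 0‖ₑ ^ p * J ≤ ∫⁻ w in ball (0 : Cn n) 1, ‖G w‖ₑ ^ p * W ‖w‖ :=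
          enorm_rpow_mul_lintegral_le hp hGd hWm
      _ = ∫⁻ w in ball (0 : Cn n) 1,
          ENNReal.ofReal ((‖(s / (1 + t * inner ℂ e w) : ℂ)‖ ^ 2) ^ (n + 1)) *
            (‖f (ballShift e t s w)‖ₑ ^ p * W ‖ballShift e t s w‖) := by
          refine setLIntegral_congr_fun isOpen_ball.measurableSet fun w hw => ?_
          have hd0 := one_add_inner_ne_zero he ht0 ht1 hw
          have hw1 : ‖w‖ < 1 := mem_ball_zero_iff.1 hw
          have hwpos : 0 ≤ 1 - ‖w‖ ^ 2 := by nlinarith [norm_nonneg w]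
          simp only [hW]
          rw [one_sub_norm_ballShift_sq he hs hd0, ← ofReal_norm (G w), hGn w hw,
            ← ofReal_norm (f _)]
          have hq : 0 < ‖(s / (1 + t * inner ℂ e w) : ℂ)‖ :=
            norm_pos_iff.2 (div_ne_zero (Complex.ofReal_ne_zero.2 hspos.ne') hd0)
          generalize ‖(s / (1 + t * inner ℂ e w) : ℂ)‖ = q at hq
          rw [ENNReal.ofReal_rpow_of_nonneg (by positivity) hp.le,
            ENNReal.ofReal_rpow_of_nonneg (norm_nonneg _) hp.le,
            ← ENNReal.ofReal_mul (by positivity), ← ENNReal.ofReal_mul (by positivity),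
            ← ENNReal.ofReal_mul (by positivity)]
          congr 1
          rw [Real.mul_rpow (by positivity) (norm_nonneg _), ← Real.rpow_mul hq.le, hγp,
            Real.mul_rpow (by positivity) hwpos, Real.rpow_mul hq.le,
            Real.rpow_add (by positivity)]
          norm_cast
          ring
      _ ≤ ∫⁻ z in ball (0 : Cn n) 1, ‖f z‖ₑ ^ p * W ‖z‖ :=
          lintegral_comp_ballShift_le he ht0 ht1 hs hspos.ne' fun z => ‖f z‖ₑ ^ p * W ‖z‖
      _ ≤ hardyNorm p f ^ p * J :=
          lintegral_ball_le_hardyNorm hn hp hf.continuousOn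
            (hfK.trans_lt ENNReal.ofReal_lt_top).ne hWm
      _ ≤ ENNReal.ofReal K ^ p * J := mul_le_mul_left (ENNReal.rpow_le_rpow hfK hp.le) _
  have hJ0 : J ≠ 0 := lintegral_one_sub_norm_sq_rpow_ne_zero hβ0
  have hJt : J ≠ ∞ := lintegral_one_sub_norm_sq_rpow_ne_top hn hβ hβ0
  rw [ENNReal.mul_le_mul_iff_left hJ0 hJt, ← ofReal_norm,
    ENNReal.ofReal_rpow_of_nonneg (norm_nonneg _) hp.le, ENNReal.ofReal_rpow_of_nonneg hK hp.le,
    ENNReal.ofReal_le_ofReal_iff (by positivity), hGn 0 (mem_ball_self one_pos), ballShift_zero,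
    inner_zero_right, mul_zero, add_zero, div_one, Complex.norm_real,
    Real.norm_of_nonneg hspos.le, Real.mul_rpow (by positivity) (norm_nonneg _),
    ← Real.rpow_mul hspos.le, hγp, Real.rpow_mul hspos.le, Real.rpow_two, hs] at hkey
  exact hkey

/-- Growth of Hardy maps: `‖f z‖ ≤ ‖f‖_p (1 - ‖z‖ ^ 2) ^ (-n / p)`. -/
theorem norm_le_of_hardyNorm_le {n : ℕ} (hn : 1 ≤ n) {p : ℝ} (hp : 0 < p) {f : Cn n → Cn n}
    (hf : DifferentiableOn ℂ f (ball 0 1)) {K : ℝ} (hK : 0 ≤ K)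
    (hfK : hardyNorm p f ≤ ENNReal.ofReal K) {z : Cn n} (hz : z ∈ ball (0 : Cn n) 1) :
    ‖f z‖ ≤ K * (1 - ‖z‖ ^ 2) ^ (-(n / p)) := by
  have hz1 : ‖z‖ < 1 := mem_ball_zero_iff.1 hz
  have hpos : 0 < 1 - ‖z‖ ^ 2 := by nlinarith [norm_nonneg z]
  obtain ⟨e, he, hze⟩ : ∃ e : Cn n, ‖e‖ = 1 ∧ z = ((‖z‖ : ℝ) : ℂ) • e := by
    rcases eq_or_ne z 0 with rfl | h0
    · exact ⟨EuclideanSpace.single ⟨0, hn⟩ 1, by simp, by simp⟩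
    · refine ⟨((‖z‖⁻¹ : ℝ) : ℂ) • z, ?_, ?_⟩
      · rw [norm_smul, Complex.norm_real, norm_inv, norm_norm,
          inv_mul_cancel₀ (norm_ne_zero_iff.2 h0)]
      · rw [smul_smul, ← Complex.ofReal_mul, mul_inv_cancel₀ (norm_ne_zero_iff.2 h0),
          Complex.ofReal_one, one_smul]
  have hle : (1 - ‖z‖ ^ 2) ^ (n : ℝ) * ‖f z‖ ^ p ≤ K ^ p := by
    have hcont : Filter.Tendsto (fun β : ℝ => (1 - ‖z‖ ^ 2) ^ (n + 1 + β) * ‖f z‖ ^ p)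
        (nhdsWithin (-1) (Ioi (-1))) (nhds ((1 - ‖z‖ ^ 2) ^ ((n : ℝ) + 1 + -1) * ‖f z‖ ^ p)) := by
      have hc : Continuous fun β : ℝ => (1 - ‖z‖ ^ 2) ^ (n + 1 + β) * ‖f z‖ ^ p :=
        ((Real.continuous_const_rpow hpos.ne').comp (by fun_prop)).mul continuous_const
      exact (hc.tendsto (-1)).mono_left nhdsWithin_le_nhds
    rw [add_neg_cancel_right] at hcont
    refine le_of_tendsto hcont ?_
    filter_upwards [Ioo_mem_nhdsGT (show (-1 : ℝ) < 0 by norm_num)] with β hβ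
    have h := rpow_mul_norm_rpow_le_of_weight hn hp hf hK hfK he (norm_nonneg z) hz1 hβ.1 hβ.2.le
    rwa [← hze] at h
  rw [← Real.rpow_le_rpow_iff (norm_nonneg _) (by positivity) hp, Real.mul_rpow hK (by positivity),
    ← Real.rpow_mul hpos.le, neg_mul, div_mul_cancel₀ _ hp.ne', Real.rpow_neg hpos.le,
    ← div_eq_mul_inv, le_div_iff₀ (by positivity), mul_comm]
  exact hle

/-! ### Contractions and determinants -/

/-- A linear contraction `A` expands no less than `|det A|`: the eigenvalues of `A* A` lie in
`[0, 1]` and their product is `|det A| ^ 2`, so that each of them is at least `|det A| ^ 2`. -/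
theorem norm_det_mul_norm_le {n : ℕ} (A : Cn n →L[ℂ] Cn n) (hA : ‖A‖ ≤ 1) (v : Cn n) :
    ‖LinearMap.det (A : Cn n →ₗ[ℂ] Cn n)‖ * ‖v‖ ≤ ‖A v‖ := by
  set L : Cn n →ₗ[ℂ] Cn n := (A : Cn n →ₗ[ℂ] Cn n) with hL
  set T : Cn n →ₗ[ℂ] Cn n := LinearMap.adjoint L ∘ₗ L with hT
  have hsym : T.IsSymmetric := fun x y => by
    simp [hT, LinearMap.adjoint_inner_left, LinearMap.adjoint_inner_right]
  have hn : Module.finrank ℂ (Cn n) = n := finrank_euclideanSpace_fin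
  set b := hsym.eigenvectorBasis hn with hb
  set μ := hsym.eigenvalues hn with hμ
  have hTb : ∀ i, T (b i) = (μ i : ℂ) • b i := fun i => hsym.apply_eigenvectorBasis hn i
  have hinner : ∀ x y, inner ℂ x (T y) = inner ℂ (A x) (A y) := fun x y => by
    simp [hT, LinearMap.adjoint_inner_right, hL]
  have hμsq : ∀ i, μ i = ‖A (b i)‖ ^ 2 := fun i => by
    have h := hinner (b i) (b i)
    rw [hTb, inner_smul_right, inner_self_eq_norm_sq_to_K, inner_self_eq_norm_sq_to_K,
      b.orthonormal.1 i] at h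
    have h' : (μ i : ℂ) = ((‖A (b i)‖ ^ 2 : ℝ) : ℂ) := by
      push_cast
      simpa using h
    exact_mod_cast h'
  have hμ0 : ∀ i, 0 ≤ μ i := fun i => by rw [hμsq]; positivity
  have hμ1 : ∀ i, μ i ≤ 1 := fun i => by
    rw [hμsq]
    have := A.le_of_opNorm_le hA (b i)
    rw [b.orthonormal.1 i, mul_one] at this
    exact pow_le_one₀ (norm_nonneg _) this
  have hprod : ∏ i, μ i = ‖LinearMap.det L‖ ^ 2 := by
    have h : ((∏ i, μ i : ℝ) : ℂ) = ((‖LinearMap.det L‖ ^ 2 : ℝ) : ℂ) := by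
      rw [← L.normDet_eq_norm_det]
      refine Eq.trans ?_ L.normDet_sq.symm
      rw [hsym.det_eq_prod_eigenvalues hn]
      push_cast
      rfl
    exact_mod_cast h
  have hge : ∀ i, ‖LinearMap.det L‖ ^ 2 ≤ μ i := fun i => by
    rw [← hprod, ← Finset.mul_prod_erase _ _ (Finset.mem_univ i)]
    exact mul_le_of_le_one_right (hμ0 i) (Finset.prod_le_one (fun j _ => hμ0 j) fun j _ => hμ1 j)
  have hsum : ‖A v‖ ^ 2 = ∑ i, μ i * ‖(inner ℂ (b i) v : ℂ)‖ ^ 2 := by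
    have h : ((‖A v‖ ^ 2 : ℝ) : ℂ) = ((∑ i, μ i * ‖(inner ℂ (b i) v : ℂ)‖ ^ 2 : ℝ) : ℂ) := by
      have h1 := hinner v v
      rw [inner_self_eq_norm_sq_to_K, ← b.sum_inner_mul_inner] at h1
      push_cast at h1 ⊢
      refine h1.symm.trans (Finset.sum_congr rfl fun i _ => ?_)
      rw [← hsym, hTb, inner_smul_left, Complex.conj_ofReal, ← inner_conj_symm v (b i),
        ← Complex.conj_mul']
      ring
    exact_mod_cast h
  refine le_of_sq_le_sq ?_ (norm_nonneg _)
  rw [mul_pow, hsum, ← b.sum_sq_norm_inner_right, Finset.mul_sum]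
  exact Finset.sum_le_sum fun i _ => mul_le_mul_of_nonneg_right (hge i) (by positivity)

/-! ### Schwarz–Pick estimates for the derivative -/

/-- The derivative form of the Schwarz–Pick lemma on a disc of radius `ρ`, without its factor
`1 - ‖g b‖ ^ 2`: precompose with the Möbius map that takes `0` to `b` and apply Cauchy's
estimate. -/
theorem norm_deriv_le_of_norm_le_one {E : Type*} [NormedAddCommGroup E] [NormedSpace ℂ E]
    {g : ℂ → E} {ρ : ℝ} (hρ : 0 < ρ) (hg : DifferentiableOn ℂ g (ball 0 ρ))
    (hg1 : ∀ ζ ∈ ball (0 : ℂ) ρ, ‖g ζ‖ ≤ 1) {b : ℂ} (hb : b ∈ ball (0 : ℂ) ρ) :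
    ‖deriv g b‖ ≤ ρ / (ρ ^ 2 - ‖b‖ ^ 2) := by
  set a : ℂ := b / ρ with ha
  have hρc : (ρ : ℂ) ≠ 0 := Complex.ofReal_ne_zero.2 hρ.ne'
  have hbρ : ‖b‖ < ρ := mem_ball_zero_iff.1 hb
  have hna : ‖a‖ = ‖b‖ / ρ := by rw [ha, norm_div, Complex.norm_real, Real.norm_of_nonneg hρ.le]
  have ha1 : ‖a‖ < 1 := by rwa [hna, div_lt_one hρ]
  set m : ℂ → ℂ := fun w => ρ * ((w + a) / (1 + starRingEnd ℂ a * w)) with hm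
  have hden : ∀ w ∈ ball (0 : ℂ) 1, 1 + starRingEnd ℂ a * w ≠ 0 := by
    intro w hw h
    have h1 : ‖starRingEnd ℂ a * w‖ = 1 := by
      rw [eq_neg_of_add_eq_zero_right h, norm_neg, norm_one]
    rw [norm_mul, RCLike.norm_conj] at h1
    have hw1 : ‖w‖ < 1 := mem_ball_zero_iff.1 hw
    nlinarith [norm_nonneg a, norm_nonneg w]
  have hmaps : MapsTo m (ball 0 1) (ball 0 ρ) := by
    intro w hw
    have hw1 : ‖w‖ < 1 := mem_ball_zero_iff.1 hw
    have hd := norm_pos_iff.2 (hden w hw)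
    rw [mem_ball_zero_iff, hm]
    simp only [norm_mul, norm_div, Complex.norm_real, Real.norm_of_nonneg hρ.le]
    rw [mul_lt_iff_lt_one_right hρ, div_lt_one hd]
    refine lt_of_pow_lt_pow_left₀ 2 hd.le ?_
    have h3 : ‖1 + starRingEnd ℂ a * w‖ ^ 2 - ‖w + a‖ ^ 2 = (1 - ‖a‖ ^ 2) * (1 - ‖w‖ ^ 2) := by
      simp only [Complex.sq_norm, Complex.normSq_apply, Complex.add_re, Complex.add_im,
        Complex.mul_re, Complex.mul_im, Complex.conj_re, Complex.conj_im, Complex.one_re,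
        Complex.one_im]
      ring
    have h4 : 0 < (1 - ‖a‖ ^ 2) * (1 - ‖w‖ ^ 2) :=
      mul_pos (by nlinarith [norm_nonneg a]) (by nlinarith [norm_nonneg w])
    linarith
  have hmd : DifferentiableOn ℂ m (ball 0 1) := by
    have h1 : DifferentiableOn ℂ (fun w : ℂ => w + a) (ball 0 1) := by fun_prop
    have h2 : DifferentiableOn ℂ (fun w : ℂ => 1 + starRingEnd ℂ a * w) (ball 0 1) := by fun_prop
    exact (h1.div h2 hden).const_mul _
  have hm0 : m 0 = b := by simp [hm, ha, mul_div_cancel₀ _ hρc]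
  have hm' : HasDerivAt m (ρ * (1 - ‖a‖ ^ 2 : ℝ)) 0 := by
    have h1 : HasDerivAt (fun w : ℂ => w + a) 1 0 := (hasDerivAt_id 0).add_const a
    have h2 : HasDerivAt (fun w : ℂ => 1 + starRingEnd ℂ a * w) (starRingEnd ℂ a) 0 := by
      simpa using ((hasDerivAt_id (0 : ℂ)).const_mul (starRingEnd ℂ a)).const_add 1
    have h3 := (h1.div h2 (hden 0 (mem_ball_self one_pos))).const_mul (ρ : ℂ)
    refine h3.congr_deriv ?_
    push_cast
    rw [← Complex.mul_conj']
    simp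
  have hgb : HasDerivAt g (deriv g b) (m 0) := by
    rw [hm0]
    exact (hg.differentiableAt (isOpen_ball.mem_nhds hb)).hasDerivAt
  have hcomp := hgb.scomp (0 : ℂ) hm'
  have hcompd : DifferentiableOn ℂ (g ∘ m) (ball 0 1) := hg.comp hmd hmaps
  have hcauchy : ‖deriv (g ∘ m) 0‖ ≤ 1 := by
    have hr : ∀ r ∈ Ioo (0 : ℝ) 1, ‖deriv (g ∘ m) 0‖ * r ≤ 1 := by
      intro r hr
      rw [← le_div_iff₀ hr.1]
      have hsub : closedBall (0 : ℂ) r ⊆ ball 0 1 := closedBall_subset_ball hr.2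
      refine Complex.norm_deriv_le_of_forall_mem_sphere_norm_le hr.1 ?_ fun w hw =>
        hg1 _ (hmaps (hsub (sphere_subset_closedBall hw)))
      exact (hcompd.mono (by rwa [closure_ball _ hr.1.ne'])).diffContOnCl
    have hlim : Filter.Tendsto (fun r : ℝ => ‖deriv (g ∘ m) 0‖ * r) (nhdsWithin 1 (Iio 1))
        (nhds (‖deriv (g ∘ m) 0‖ * 1)) :=
      ((continuous_const.mul continuous_id).tendsto 1).mono_left nhdsWithin_le_nhds
    rw [mul_one] at hlim
    refine le_of_tendsto hlim ?_
    filter_upwards [Ioo_mem_nhdsLT (zero_lt_one (α := ℝ))] with r h using hr r h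
  rw [hcomp.deriv, norm_smul, norm_mul, Complex.norm_real, Complex.norm_real,
    Real.norm_of_nonneg hρ.le, hna, Real.norm_of_nonneg] at hcauchy
  · have hpos : 0 < ρ ^ 2 - ‖b‖ ^ 2 := by nlinarith [norm_nonneg b]
    rw [le_div_iff₀ hpos]
    calc ‖deriv g b‖ * (ρ ^ 2 - ‖b‖ ^ 2)
        = ρ * (ρ * (1 - (‖b‖ / ρ) ^ 2) * ‖deriv g b‖) := by field_simp
      _ ≤ ρ * 1 := mul_le_mul_of_nonneg_left hcauchy hρ.le
      _ = ρ := mul_one ρ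
  · rw [← hna]
    nlinarith [norm_nonneg a]

/-- Restrict `F` to the disc that the complex line through `z` with direction `v` cuts out of the
ball. If `c` is the point of that line closest to `0`, the disc has radius `√(1 - ‖c‖ ^ 2) ≤ 1`. -/
theorem norm_fderiv_le_of_norm_le_one {n : ℕ} {F : Cn n → Cn n}
    (hF : DifferentiableOn ℂ F (ball 0 1)) (hF1 : ∀ z ∈ ball (0 : Cn n) 1, ‖F z‖ ≤ 1) {z : Cn n}
    (hz : z ∈ ball (0 : Cn n) 1) : ‖fderiv ℂ F z‖ ≤ 1 / (1 - ‖z‖ ^ 2) := by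
  have hz1 : ‖z‖ < 1 := mem_ball_zero_iff.1 hz
  have hzpos : 0 < 1 - ‖z‖ ^ 2 := by nlinarith [norm_nonneg z]
  have hunit : ∀ v : Cn n, ‖v‖ = 1 → ‖fderiv ℂ F z v‖ ≤ 1 / (1 - ‖z‖ ^ 2) := by
    intro v hv
    set b : ℂ := inner ℂ v z with hb
    set c : Cn n := z - b • v with hc
    have hvc : inner ℂ v c = 0 := by
      rw [hc, inner_sub_right, inner_smul_right, inner_self_eq_norm_sq_to_K, hv, hb]
      simp
    have hnorm : ∀ ζ : ℂ, ‖c + ζ • v‖ ^ 2 = ‖c‖ ^ 2 + ‖ζ‖ ^ 2 := by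
      intro ζ
      have hcv : inner ℂ c (ζ • v) = 0 := by
        rw [inner_smul_right, ← inner_conj_symm, hvc, map_zero, mul_zero]
      have := norm_add_sq_eq_norm_sq_add_norm_sq_of_inner_eq_zero c (ζ • v) hcv
      rw [norm_smul, hv, mul_one] at this
      linarith [this, sq ‖c + ζ • v‖, sq ‖c‖, sq ‖ζ‖]
    have hcz : c + b • v = z := sub_add_cancel z _
    have hzn : ‖z‖ ^ 2 = ‖c‖ ^ 2 + ‖b‖ ^ 2 := by rw [← hnorm, hcz]
    set ρ : ℝ := √(1 - ‖c‖ ^ 2) with hρdef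
    have hcpos : 0 < 1 - ‖c‖ ^ 2 := by nlinarith [sq_nonneg ‖b‖]
    have hρ : 0 < ρ := Real.sqrt_pos.2 hcpos
    have hρ2 : ρ ^ 2 = 1 - ‖c‖ ^ 2 := Real.sq_sqrt hcpos.le
    have hmaps : MapsTo (fun ζ : ℂ => c + ζ • v) (ball 0 ρ) (ball 0 1) := by
      intro ζ hζ
      rw [mem_ball_zero_iff] at hζ ⊢
      refine lt_of_pow_lt_pow_left₀ 2 zero_le_one ?_
      rw [hnorm]
      nlinarith [norm_nonneg ζ]
    have hbmem : b ∈ ball (0 : ℂ) ρ := by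
      rw [mem_ball_zero_iff]
      refine lt_of_pow_lt_pow_left₀ 2 hρ.le ?_
      linarith
    have hgd : DifferentiableOn ℂ (fun ζ : ℂ => F (c + ζ • v)) (ball 0 ρ) :=
      hF.comp (by fun_prop) hmaps
    have h := norm_deriv_le_of_norm_le_one hρ hgd (fun ζ hζ => hF1 _ (hmaps hζ)) hbmem
    have hFz : HasFDerivAt F (fderiv ℂ F z) (c + b • v) := by
      rw [hcz]
      exact (hF.differentiableAt (isOpen_ball.mem_nhds hz)).hasFDerivAt
    have hline : HasDerivAt (fun ζ : ℂ => c + ζ • v) v b := by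
      simpa using ((hasDerivAt_id b).smul_const v).const_add c
    have hder : deriv (fun ζ : ℂ => F (c + ζ • v)) b = fderiv ℂ F z v :=
      (hFz.comp_hasDerivAt b hline).deriv
    rw [hder, show ρ ^ 2 - ‖b‖ ^ 2 = 1 - ‖z‖ ^ 2 by rw [hρ2, hzn]; ring] at h
    refine h.trans (div_le_div_of_nonneg_right ?_ hzpos.le)
    exact Real.sqrt_le_one.2 (by nlinarith [sq_nonneg ‖c‖])
  refine ContinuousLinearMap.opNorm_le_bound _ (by positivity) fun v => ?_
  rcases eq_or_ne v 0 with rfl | hv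
  · simp
  have h := hunit (((‖v‖⁻¹ : ℝ) : ℂ) • v) (by
    rw [norm_smul, Complex.norm_real, norm_inv, norm_norm, inv_mul_cancel₀ (norm_ne_zero_iff.2 hv)])
  rw [map_smul, norm_smul, Complex.norm_real, norm_inv, norm_norm,
    inv_mul_le_iff₀ (by positivity)] at h
  rwa [mul_comm]

/-- The Schwarz lemma for `fderiv F - fderiv F 0` on the ball of radius `s`. It is applied to the
difference quotients of `F` in a direction `v`, whose holomorphy, unlike that of the derivative,
is immediate. -/
theorem norm_fderiv_sub_le {n : ℕ} {F : Cn n → Cn n}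
    (hF : DifferentiableOn ℂ F (ball 0 1)) (hF1 : ∀ z ∈ ball (0 : Cn n) 1, ‖F z‖ ≤ 1)
    (hF0 : F 0 = 0) {s : ℝ} (hs1 : s < 1) {z : Cn n} (hz : ‖z‖ < s) :
    ‖fderiv ℂ F z - fderiv ℂ F 0‖ ≤ (1 / (1 - s ^ 2) + 1) / s * ‖z‖ := by
  have hs0 : 0 < s := (norm_nonneg z).trans_lt hz
  have hspos : 0 < 1 - s ^ 2 := by nlinarith
  set C := 1 / (1 - s ^ 2) with hC
  have hCpos : 0 < C := by positivity
  have hsub : ball (0 : Cn n) s ⊆ ball 0 1 := ball_subset_ball hs1.le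
  have hdiff : ∀ x ∈ ball (0 : Cn n) 1, DifferentiableAt ℂ F x := fun x hx =>
    hF.differentiableAt (isOpen_ball.mem_nhds hx)
  have hlip : ∀ x ∈ ball (0 : Cn n) s, ∀ y ∈ ball (0 : Cn n) s, ‖F y - F x‖ ≤ C * ‖y - x‖ := by
    intro x hx y hy
    refine (convex_ball (0 : Cn n) s).norm_image_sub_le_of_norm_fderiv_le (𝕜 := ℂ)
      (fun w hw => hdiff w (hsub hw)) (fun w hw => ?_) hx hy
    refine (norm_fderiv_le_of_norm_le_one hF hF1 (hsub hw)).trans ?_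
    have hw1 : ‖w‖ < s := mem_ball_zero_iff.1 hw
    exact one_div_le_one_div_of_le hspos (by nlinarith [norm_nonneg w])
  have hschwarz : ∀ x ∈ ball (0 : Cn n) 1, ‖F x‖ ≤ ‖x‖ := fun x hx =>
    Complex.norm_le_norm_of_mapsTo_ball hF (fun w hw => mem_closedBall_zero_iff.2 (hF1 w hw)) hF0
      (mem_ball_zero_iff.1 hx)
  have hinner : ∀ s' : ℝ, ‖z‖ < s' → s' < s → ∀ v : Cn n,
      ‖(fderiv ℂ F z - fderiv ℂ F 0) v‖ ≤ (C + 1) * ‖v‖ / s' * ‖z‖ := by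
    intro s' hzs' hs's v
    have hs'0 : 0 < s' := (norm_nonneg z).trans_lt hzs'
    have hquot : ∀ τ : ℝ, 0 < τ → τ * ‖v‖ < s - s' →
        ‖τ⁻¹ • (F (z + τ • v) - F z) - τ⁻¹ • (F (0 + τ • v) - F 0)‖ ≤
          (C + 1) * ‖v‖ / s' * ‖z‖ := by
      intro τ hτ hτv
      have hnτ : ‖τ • v‖ = τ * ‖v‖ := by rw [norm_smul, Real.norm_of_nonneg hτ.le]
      set D : Cn n → Cn n := fun x =>
        (τ : ℂ)⁻¹ • (F (x + τ • v) - F x) - (τ : ℂ)⁻¹ • (F (0 + τ • v) - F 0) with hD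
      have hshift : ∀ x ∈ ball (0 : Cn n) s', x + τ • v ∈ ball (0 : Cn n) s := by
        intro x hx
        rw [mem_ball_zero_iff] at hx ⊢
        refine (norm_add_le _ _).trans_lt ?_
        rw [hnτ]; linarith
      have hx' : ∀ x ∈ ball (0 : Cn n) s', x ∈ ball (0 : Cn n) s := fun x hx =>
        ball_subset_ball hs's.le hx
      have hD0 : D 0 = 0 := sub_self _
      have hDd : DifferentiableOn ℂ D (ball 0 s') := by
        have h1 : DifferentiableOn ℂ (fun x => F (x + τ • v)) (ball 0 s') :=
          hF.comp (by fun_prop) fun x hx => hsub (hshift x hx)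
        have h2 : DifferentiableOn ℂ F (ball 0 s') := hF.mono fun x hx => hsub (hx' x hx)
        exact ((h1.sub h2).const_smul ((τ : ℂ)⁻¹)).sub_const _
      have hnorminv : ‖(τ : ℂ)⁻¹‖ = τ⁻¹ := by
        rw [norm_inv, Complex.norm_real, Real.norm_of_nonneg hτ.le]
      have hDb : MapsTo D (ball 0 s') (closedBall (D 0) ((C + 1) * ‖v‖)) := by
        intro x hx
        rw [hD0, mem_closedBall_zero_iff]
        have h1 := hlip x (hx' x hx) _ (hshift x hx)
        rw [add_sub_cancel_left, hnτ] at h1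
        have h2 := hschwarz _ (hsub (hshift 0 (mem_ball_self hs'0)))
        rw [zero_add, hnτ] at h2
        refine (norm_sub_le _ _).trans ?_
        rw [norm_smul, norm_smul, hnorminv, hF0, sub_zero, zero_add]
        calc τ⁻¹ * ‖F (x + τ • v) - F x‖ + τ⁻¹ * ‖F (τ • v)‖
            ≤ τ⁻¹ * (C * (τ * ‖v‖)) + τ⁻¹ * (τ * ‖v‖) := by gcongr
          _ = (C + 1) * ‖v‖ := by field_simp
      have h := Complex.dist_le_div_mul_dist_of_mapsTo_ball hDd hDb (mem_ball_zero_iff.2 hzs')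
      rw [hD0, dist_zero_right, dist_zero_right] at h
      simpa only [hD, ← Complex.ofReal_inv, Complex.coe_smul] using h
    have hlim : ∀ x ∈ ball (0 : Cn n) 1, Filter.Tendsto
        (fun τ : ℝ => τ⁻¹ • (F (x + τ • v) - F x)) (nhdsWithin 0 (Ioi 0))
        (nhds (fderiv ℂ F x v)) := by
      intro x hx
      have h := ((hdiff x hx).hasFDerivAt.restrictScalars ℝ).hasLineDerivAt v
      exact h.tendsto_slope_zero_right
    have htend := ((hlim z (mem_ball_zero_iff.2 (hz.trans hs1))).sub
      (hlim 0 (mem_ball_self one_pos))).norm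
    refine le_of_tendsto htend ?_
    have hev : ∀ᶠ τ : ℝ in nhdsWithin 0 (Ioi 0), τ * ‖v‖ < s - s' := by
      have hc : Filter.Tendsto (fun τ : ℝ => τ * ‖v‖) (nhdsWithin 0 (Ioi 0)) (nhds (0 * ‖v‖)) :=
        ((continuous_id.mul continuous_const).tendsto 0).mono_left nhdsWithin_le_nhds
      rw [zero_mul] at hc
      exact hc.eventually_lt_const (sub_pos.2 hs's)
    filter_upwards [hev, self_mem_nhdsWithin] with τ h1 h2 using hquot τ h2 h1
  refine ContinuousLinearMap.opNorm_le_bound _ (by positivity) fun v => ?_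
  have hlim : Filter.Tendsto (fun s' : ℝ => (C + 1) * ‖v‖ / s' * ‖z‖) (nhdsWithin s (Iio s))
      (nhds ((C + 1) * ‖v‖ / s * ‖z‖)) := by
    refine Filter.Tendsto.mono_left ?_ nhdsWithin_le_nhds
    exact (tendsto_const_nhds.div Filter.tendsto_id hs0.ne').mul_const _
  refine (ge_of_tendsto hlim ?_).trans_eq (by ring)
  filter_upwards [Ioo_mem_nhdsLT hz] with s' hs' using hinner s' hs'.1 hs'.2 v

/-! ### Univalence from control of the derivative -/

/-- An injective endomorphism as a continuous linear equivalence. -/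
theorem exists_equiv_of_le_norm {n : ℕ} {A : Cn n →L[ℂ] Cn n} {a : ℝ} (ha : 0 < a)
    (hA : ∀ v, a * ‖v‖ ≤ ‖A v‖) :
    ∃ e : Cn n ≃L[ℂ] Cn n, (e : Cn n →L[ℂ] Cn n) = A ∧
      ‖(e.symm : Cn n →L[ℂ] Cn n)‖ ≤ a⁻¹ := by
  have hinj : Function.Injective (A : Cn n →ₗ[ℂ] Cn n) := by
    rw [← LinearMap.ker_eq_bot, LinearMap.ker_eq_bot']
    intro v hv
    have h := hA v
    have hv' : A v = 0 := hv
    rw [hv', norm_zero] at h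
    exact norm_le_zero_iff.1 (nonpos_of_mul_nonpos_right h ha)
  let e := (LinearEquiv.ofInjectiveEndo (A : Cn n →ₗ[ℂ] Cn n) hinj).toContinuousLinearEquiv
  have he : ∀ v, e v = A v := fun v => rfl
  refine ⟨e, ContinuousLinearMap.ext he, ContinuousLinearMap.opNorm_le_bound _ (by positivity)
    fun w => ?_⟩
  have h := hA (e.symm w)
  rw [← he, e.apply_symm_apply] at h
  rw [le_inv_mul_iff₀ ha]
  exact h

section

variable {n : ℕ} {f : Cn n → Cn n} {a c : ℝ}

/-- By the mean value inequality `f` is close to its derivative at `0` in the Lipschitz sense. -/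
theorem approximatesLinearOn_of_fderiv_sub_le (hc : 0 < c)
    (hf : DifferentiableOn ℂ f (ball 0 (a / c)))
    (hfc : ∀ z ∈ ball (0 : Cn n) (a / c), ‖fderiv ℂ f z - fderiv ℂ f 0‖ ≤ c * ‖z‖)
    {ρ : ℝ} (hρ0 : 0 ≤ ρ) (hρ : ρ < a / c) :
    ApproximatesLinearOn f (fderiv ℂ f 0) (ball 0 ρ) (Real.toNNReal (c * ρ)) := by
  have hsub : ball (0 : Cn n) ρ ⊆ ball 0 (a / c) := ball_subset_ball hρ.le
  have hd : ∀ z ∈ ball (0 : Cn n) ρ, HasFDerivWithinAt f (fderiv ℂ f z) (ball 0 ρ) z := fun z hz =>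
    (hf.differentiableAt (isOpen_ball.mem_nhds (hsub hz))).hasFDerivAt.hasFDerivWithinAt
  intro x hx y hy
  rw [Real.coe_toNNReal _ (by positivity)]
  refine (convex_ball (0 : Cn n) ρ).norm_image_sub_le_of_norm_hasFDerivWithin_le' hd
    (fun z hz => (hfc z (hsub hz)).trans ?_) hy hx
  exact mul_le_mul_of_nonneg_left (mem_ball_zero_iff.1 hz).le hc.le

/-- Integrate `‖fderiv f z - fderiv f 0‖ ≤ c ‖z‖` along the segment from `0` to `z`. -/
theorem mul_norm_sub_le_norm_apply (hf0 : f 0 = 0) (hA : ∀ v, a * ‖v‖ ≤ ‖fderiv ℂ f 0 v‖)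
    (hf : DifferentiableOn ℂ f (ball 0 (a / c)))
    (hfc : ∀ z ∈ ball (0 : Cn n) (a / c), ‖fderiv ℂ f z - fderiv ℂ f 0‖ ≤ c * ‖z‖)
    {z : Cn n} (hz : z ∈ ball (0 : Cn n) (a / c)) : a * ‖z‖ - c * ‖z‖ ^ 2 / 2 ≤ ‖f z‖ := by
  set A := fderiv ℂ f 0 with hAdef
  set g : ℝ → Cn n := fun t => f (t • z) - A (t • z) with hg
  have hmem : ∀ t ∈ Icc (0 : ℝ) 1, t • z ∈ ball (0 : Cn n) (a / c) := by
    intro t ht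
    rw [mem_ball_zero_iff] at hz ⊢
    rw [norm_smul, Real.norm_of_nonneg ht.1]
    exact (mul_le_of_le_one_left (norm_nonneg _) ht.2).trans_lt hz
  have hgd : ∀ t ∈ Icc (0 : ℝ) 1, HasDerivAt g ((fderiv ℂ f (t • z) - A) z) t := by
    intro t ht
    have hline : HasDerivAt (fun t : ℝ => t • z) z t := by
      simpa using (hasDerivAt_id t).smul_const z
    have h1 := ((hf.differentiableAt (isOpen_ball.mem_nhds
      (hmem t ht))).hasFDerivAt.restrictScalars ℝ).comp_hasDerivAt t hline
    have h2 := ((A.hasFDerivAt (x := t • z)).restrictScalars ℝ).comp_hasDerivAt t hline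
    exact h1.sub h2
  have hB : ∀ t : ℝ, HasDerivAt (fun t : ℝ => c * ‖z‖ ^ 2 * t ^ 2 / 2) (c * ‖z‖ ^ 2 * t) t := by
    intro t
    have := (((hasDerivAt_id t).pow 2).const_mul (c * ‖z‖ ^ 2)).div_const 2
    refine this.congr_deriv ?_
    simp
    ring
  have h := image_norm_le_of_norm_deriv_right_le_deriv_boundary (f := g) (a := 0) (b := 1)
    (fun t ht => (hgd t ht).continuousAt.continuousWithinAt)
    (fun t ht => (hgd t (Ico_subset_Icc_self ht)).hasDerivWithinAt)
    (B := fun t => c * ‖z‖ ^ 2 * t ^ 2 / 2) (by simp [hg, hf0]) hB (fun t ht => ?_)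
    (right_mem_Icc.2 zero_le_one)
  · simp only [hg, one_smul, one_pow, mul_one] at h
    have h3 := norm_sub_norm_le (A z) (f z)
    rw [norm_sub_rev] at h3
    linarith [hA z]
  · refine (ContinuousLinearMap.le_opNorm _ _).trans ?_
    have h4 := hfc _ (hmem t (Ico_subset_Icc_self ht))
    rw [norm_smul, Real.norm_of_nonneg ht.1] at h4
    calc _ ≤ c * (t * ‖z‖) * ‖z‖ := mul_le_mul_of_nonneg_right h4 (norm_nonneg _)
      _ = c * ‖z‖ ^ 2 * t := by ring

/-- On smaller concentric balls `f` is a partial homeomorphism. -/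
theorem exists_openPartialHomeomorph_of_fderiv_sub_le (ha : 0 < a) (hc : 0 < c)
    (hA : ∀ v, a * ‖v‖ ≤ ‖fderiv ℂ f 0 v‖) (hf : DifferentiableOn ℂ f (ball 0 (a / c)))
    (hfc : ∀ z ∈ ball (0 : Cn n) (a / c), ‖fderiv ℂ f z - fderiv ℂ f 0‖ ≤ c * ‖z‖)
    {ρ : ℝ} (hρ0 : 0 ≤ ρ) (hρ : ρ < a / c) :
    ∃ Φ : OpenPartialHomeomorph (Cn n) (Cn n), ⇑Φ = f ∧ Φ.source = ball 0 ρ := by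
  obtain ⟨e, heA, hes⟩ := exists_equiv_of_le_norm ha hA
  have happ := approximatesLinearOn_of_fderiv_sub_le hc hf hfc hρ0 hρ
  rw [← heA] at happ
  have hconst : Subsingleton (Cn n) ∨ Real.toNNReal (c * ρ) < ‖(e.symm : Cn n →L[ℂ] Cn n)‖₊⁻¹ := by
    rcases subsingleton_or_nontrivial (Cn n) with h | h
    · exact Or.inl h
    · right
      have hpos : 0 < ‖(e.symm : Cn n →L[ℂ] Cn n)‖ := e.symm.norm_pos
      rw [← NNReal.coe_lt_coe, Real.coe_toNNReal _ (by positivity), NNReal.coe_inv, coe_nnnorm]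
      have h1 : c * ρ < a := by rwa [lt_div_iff₀' hc] at hρ
      exact h1.trans_le (by rwa [le_inv_comm₀ ha hpos])
  exact ⟨happ.toOpenPartialHomeomorph f (ball 0 ρ) hconst isOpen_ball, rfl, rfl⟩

theorem injOn_of_fderiv_sub_le (ha : 0 < a) (hc : 0 < c)
    (hA : ∀ v, a * ‖v‖ ≤ ‖fderiv ℂ f 0 v‖) (hf : DifferentiableOn ℂ f (ball 0 (a / c)))
    (hfc : ∀ z ∈ ball (0 : Cn n) (a / c), ‖fderiv ℂ f z - fderiv ℂ f 0‖ ≤ c * ‖z‖) :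
    InjOn f (ball 0 (a / c)) := by
  intro x hx y hy hxy
  rw [mem_ball_zero_iff] at hx hy
  obtain ⟨ρ, hρ1, hρ2⟩ := exists_between (max_lt hx hy)
  obtain ⟨Φ, hΦ, hsrc⟩ := exists_openPartialHomeomorph_of_fderiv_sub_le ha hc hA hf hfc
    ((norm_nonneg x).trans ((le_max_left _ _).trans hρ1.le)) hρ2
  have hinj := Φ.injOn
  rw [hΦ, hsrc] at hinj
  exact hinj (mem_ball_zero_iff.2 ((le_max_left _ _).trans_lt hρ1))
    (mem_ball_zero_iff.2 ((le_max_right _ _).trans_lt hρ1)) hxy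

/-- The image of a slightly smaller ball is open, and relatively closed in the ball of radius
`a ρ - c ρ ^ 2 / 2` because `f` takes the sphere of radius `ρ` outside of it. -/
theorem ball_subset_image_of_fderiv_sub_le (ha : 0 < a) (hc : 0 < c) (hf0 : f 0 = 0)
    (hA : ∀ v, a * ‖v‖ ≤ ‖fderiv ℂ f 0 v‖) (hf : DifferentiableOn ℂ f (ball 0 (a / c)))
    (hfc : ∀ z ∈ ball (0 : Cn n) (a / c), ‖fderiv ℂ f z - fderiv ℂ f 0‖ ≤ c * ‖z‖)
    {ρ : ℝ} (hρ0 : 0 < ρ) (hρ : ρ < a / c) :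
    ball (0 : Cn n) (a * ρ - c * ρ ^ 2 / 2) ⊆ f '' ball 0 ρ := by
  obtain ⟨Φ, hΦ, hsrc⟩ := exists_openPartialHomeomorph_of_fderiv_sub_le ha hc hA hf hfc hρ0.le hρ
  have hopen : IsOpen (f '' ball 0 ρ) := by
    rw [← hsrc, ← hΦ, Φ.image_source_eq_target]
    exact Φ.open_target
  have hcompact : IsCompact (f '' closedBall 0 ρ) :=
    (isCompact_closedBall _ _).image_of_continuousOn
      (hf.continuousOn.mono (closedBall_subset_ball hρ))
  have hpos : 0 < a * ρ - c * ρ ^ 2 / 2 := by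
    have : c * ρ < a := by rwa [lt_div_iff₀' hc] at hρ
    nlinarith
  have h0 : (0 : Cn n) ∈ f '' ball 0 ρ := ⟨0, mem_ball_self hρ0, hf0⟩
  have hpre : IsPreconnected (ball (0 : Cn n) (a * ρ - c * ρ ^ 2 / 2)) :=
    (convex_ball _ _).isPreconnected
  refine hpre.subset_of_closure_inter_subset hopen ⟨0, mem_ball_self hpos, h0⟩ ?_
  rintro y ⟨hy, hyR⟩
  have hcl : closure (f '' ball 0 ρ) ⊆ f '' closedBall 0 ρ :=
    closure_minimal (image_mono ball_subset_closedBall) hcompact.isClosed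
  obtain ⟨z, hz, rfl⟩ := hcl hy
  refine ⟨z, ?_, rfl⟩
  rw [mem_ball_zero_iff] at hyR ⊢
  rw [mem_closedBall_zero_iff] at hz
  refine hz.lt_of_ne fun h => ?_
  have := mul_norm_sub_le_norm_apply hf0 hA hf hfc (mem_ball_zero_iff.2 (h.trans_lt hρ))
  rw [h] at this
  exact absurd hyR (not_lt.2 this)

/-- The inverse is holomorphic because near each point it agrees with the inverse of a partial
homeomorphism, and because `‖fderiv f z v‖ ≥ (a - c ‖z‖) ‖v‖` makes the derivative invertible. -/
theorem containsUnivalentBall_of_fderiv_sub_le (ha : 0 < a) (hc : 0 < c) (hf0 : f 0 = 0)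
    (hA : ∀ v, a * ‖v‖ ≤ ‖fderiv ℂ f 0 v‖) (hf : DifferentiableOn ℂ f (ball 0 (a / c)))
    (hfc : ∀ z ∈ ball (0 : Cn n) (a / c), ‖fderiv ℂ f z - fderiv ℂ f 0‖ ≤ c * ‖z‖) :
    ContainsUnivalentBall f (ball 0 (a / c)) 0 (a ^ 2 / (2 * c)) := by
  have hρpos : 0 < a / c := div_pos ha hc
  have hinj := injOn_of_fderiv_sub_le ha hc hA hf hfc
  set V : Set (Cn n) := ball (f 0) (a ^ 2 / (2 * c)) with hV
  set U : Set (Cn n) := ball 0 (a / c) ∩ f ⁻¹' V with hU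
  -- every point of `V` has a preimage in a ball of radius less than `a / c`
  have hpre : ∀ y ∈ V, ∃ ρ, 0 < ρ ∧ ρ < a / c ∧ y ∈ f '' ball 0 ρ := by
    intro y hy
    rw [hV, hf0, mem_ball_zero_iff] at hy
    have hlim : Filter.Tendsto (fun ρ : ℝ => a * ρ - c * ρ ^ 2 / 2) (nhdsWithin (a / c) (Iio (a / c)))
        (nhds (a ^ 2 / (2 * c))) := by
      have h : Continuous fun ρ : ℝ => a * ρ - c * ρ ^ 2 / 2 := by fun_prop
      have h2 := (h.tendsto (a / c)).mono_left (nhdsWithin_le_nhds (s := Iio (a / c)))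
      convert h2 using 2
      field_simp
      ring
    obtain ⟨ρ, h1, h2⟩ := ((hlim.eventually_const_lt hy).and (Ioo_mem_nhdsLT hρpos)).exists
    exact ⟨ρ, h2.1, h2.2, ball_subset_image_of_fderiv_sub_le ha hc hf0 hA hf hfc h2.1 h2.2
      (mem_ball_zero_iff.2 h1)⟩
  have hsurj : SurjOn f U V := by
    intro y hy
    obtain ⟨ρ, -, hρ, z, hz, rfl⟩ := hpre y hy
    exact ⟨z, ⟨ball_subset_ball hρ.le hz, hy⟩, rfl⟩
  have hbij : BijOn f U V := ⟨fun z hz => hz.2, hinj.mono inter_subset_left, hsurj⟩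
  have h0V : f 0 ∈ V := mem_ball_self (by positivity)
  have h0U : (0 : Cn n) ∈ U := ⟨mem_ball_self hρpos, h0V⟩
  refine ⟨U, inter_subset_left, h0U,
    hf.continuousOn.isOpen_inter_preimage isOpen_ball isOpen_ball, isOpen_ball,
    hf.mono inter_subset_left, hbij, Function.invFunOn f U, ?_, hbij.invOn_invFunOn⟩
  intro y hy
  obtain ⟨ρ, hρ0, hρ, hyρ⟩ := hpre y hy
  obtain ⟨Φ, hΦ, hsrc⟩ := exists_openPartialHomeomorph_of_fderiv_sub_le ha hc hA hf hfc hρ0.le hρ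
  have htgt : Φ.target = f '' ball 0 ρ := by rw [← Φ.image_source_eq_target, hΦ, hsrc]
  have hytgt : y ∈ Φ.target := by rw [htgt]; exact hyρ
  have hx : Φ.symm y ∈ ball (0 : Cn n) (a / c) := by
    have := Φ.map_target hytgt
    rw [hsrc] at this
    exact ball_subset_ball hρ.le this
  -- the derivative of `f` is invertible at the preimage
  have hxn : c * ‖Φ.symm y‖ < a := by
    rw [mem_ball_zero_iff, lt_div_iff₀' hc] at hx
    exact hx
  have hder : ∀ v, (a - c * ‖Φ.symm y‖) * ‖v‖ ≤ ‖fderiv ℂ f (Φ.symm y) v‖ := by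
    intro v
    have h1 := (fderiv ℂ f (Φ.symm y) - fderiv ℂ f 0).le_of_opNorm_le (hfc _ hx) v
    have h2 := norm_sub_norm_le (fderiv ℂ f 0 v) (fderiv ℂ f (Φ.symm y) v)
    rw [norm_sub_rev] at h2
    rw [sub_apply] at h1
    linarith [hA v]
  obtain ⟨e, he, -⟩ := exists_equiv_of_le_norm (sub_pos.2 hxn) hder
  have hfe : HasFDerivAt Φ (e : Cn n →L[ℂ] Cn n) (Φ.symm y) := by
    rw [he, hΦ]
    exact (hf.differentiableAt (isOpen_ball.mem_nhds hx)).hasFDerivAt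
  refine ((Φ.hasFDerivAt_symm hytgt hfe).congr_of_eventuallyEq
    ?_).differentiableAt.differentiableWithinAt
  filter_upwards [Φ.open_target.mem_nhds hytgt, isOpen_ball.mem_nhds hy] with w hw hwV
  have hwU := hsurj hwV
  refine hinj (Function.invFunOn_mem hwU).1 ?_ ?_
  · have := Φ.map_target hw
    rw [hsrc] at this
    exact ball_subset_ball hρ.le this
  · rw [Function.invFunOn_eq hwU, ← hΦ, Φ.right_inv hw]

end

/-! ### The constant `landauM` -/

theorem sqrt_seventeen_bounds : 4.12310 < √17 ∧ √17 < 4.12311 := by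
  constructor
  · exact Real.lt_sqrt_of_sq_lt (by norm_num)
  · rw [Real.sqrt_lt' (by norm_num)]
    norm_num

theorem landauM_pos : 0 < landauM := by
  have h := sqrt_seventeen_bounds
  have : 0 < √(5 - √17) := Real.sqrt_pos.2 (by linarith [h.2])
  unfold landauM
  positivity

theorem landauM_sq : landauM ^ 2 = (7 + √17) ^ 2 / (8 * (5 - √17)) := by
  have h := sqrt_seventeen_bounds
  have h5 : 0 < 5 - √17 := by linarith [h.2]
  rw [landauM, div_pow, mul_pow, mul_pow, Real.sq_sqrt zero_le_two, Real.sq_sqrt h5.le]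
  field_simp
  norm_num

theorem abs_landauM_sub_lt : |landauM - 4.1996| < 0.0001 := by
  obtain ⟨h1, h2⟩ := sqrt_seventeen_bounds
  have h5 : 0 < 8 * (5 - √17) := by linarith
  have hsq : √17 ^ 2 = 17 := Real.sq_sqrt (by norm_num)
  rw [abs_lt]
  constructor
  · have : (4.1995 : ℝ) < landauM := by
      refine lt_of_pow_lt_pow_left₀ 2 landauM_pos.le ?_
      rw [landauM_sq, lt_div_iff₀ h5]
      nlinarith
    linarith
  · have : landauM < (4.1997 : ℝ) := by
      refine lt_of_pow_lt_pow_left₀ 2 (by norm_num) ?_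
      rw [landauM_sq, div_lt_iff₀ h5]
      nlinarith
    linarith

/-- The radius `s` at which `(1 / (1 - s ^ 2) + 1) / s` attains its minimum on `(0, 1)`, which
is `landauM`. -/
noncomputable def schwarzRadius : ℝ := √((5 - √17) / 2)

theorem schwarzRadius_spec : 0 < schwarzRadius ∧ schwarzRadius < 1 ∧
    (1 / (1 - schwarzRadius ^ 2) + 1) / schwarzRadius = landauM ∧
    1 < landauM * schwarzRadius := by
  obtain ⟨h1, h2⟩ := sqrt_seventeen_bounds
  have h17 : √17 ^ 2 = 17 := Real.sq_sqrt (by norm_num)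
  have hpos : 0 < schwarzRadius := Real.sqrt_pos.2 (by linarith)
  have hsq : schwarzRadius ^ 2 = (5 - √17) / 2 := Real.sq_sqrt (by linarith)
  have hm : landauM * schwarzRadius = (7 + √17) / 4 := by
    have h5 : 0 < √(5 - √17) := Real.sqrt_pos.2 (by linarith)
    have hr2 : 0 < √2 := Real.sqrt_pos.2 two_pos
    rw [landauM, schwarzRadius, Real.sqrt_div (by linarith)]
    field_simp
  refine ⟨hpos, by nlinarith, ?_, by rw [hm]; linarith⟩
  have h3 : √17 - 3 ≠ 0 := by linarith
  rw [div_eq_iff hpos.ne', hm, hsq, show 1 - (5 - √17) / 2 = (√17 - 3) / 2 by ring]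
  field_simp
  linear_combination -h17

/-! ### The maximum of `rhoOne` -/

/-- Weighted AM-GM: `x ^ A * (1 - x) ^ B` is maximal at `x = A / (A + B)`. -/
theorem rpow_mul_one_sub_rpow_le {A B x : ℝ} (hA : 0 < A) (hB : 0 < B) (hx0 : 0 < x) (hx1 : x < 1) :
    x ^ A * (1 - x) ^ B ≤ (A / (A + B)) ^ A * (1 - A / (A + B)) ^ B := by
  have hAB : 0 < A + B := by positivity
  set y := A / (A + B) with hy
  have hy0 : 0 < y := by positivity
  have hy1 : 1 - y = B / (A + B) := by rw [hy]; field_simp; ring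
  have hy1' : 0 < 1 - y := by rw [hy1]; positivity
  have h1x : 0 < 1 - x := by linarith
  have h := Real.geom_mean_le_arith_mean2_weighted hy0.le hy1'.le (div_pos hx0 hy0).le
    (div_pos h1x hy1').le (by ring)
  have hsum : y * (x / y) + (1 - y) * ((1 - x) / (1 - y)) = 1 := by field_simp; ring
  rw [hsum] at h
  have h2 := Real.rpow_le_one (by positivity) h hAB.le
  rw [Real.mul_rpow (by positivity) (by positivity), ← Real.rpow_mul (by positivity),
    ← Real.rpow_mul (by positivity), show y * (A + B) = A by rw [hy]; field_simp,
    show (1 - y) * (A + B) = B by rw [hy1]; field_simp, Real.div_rpow hx0.le hy0.le,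
    Real.div_rpow h1x.le hy1'.le, div_mul_div_comm, div_le_one (by positivity)] at h2
  exact h2

theorem rZero_mem_Ioo {n : ℕ} (hn : 1 ≤ n) {p : ℝ} (hp : 0 < p) : rZero n p ∈ Ioo (0 : ℝ) 1 := by
  have hn' : (0 : ℝ) < n := by exact_mod_cast hn
  refine ⟨Real.sqrt_pos.2 (by positivity), ?_⟩
  rw [rZero, Real.sqrt_lt' one_pos, one_pow, div_lt_one (by positivity)]
  nlinarith [sq_pos_of_pos hn']

theorem rZero_sq {n : ℕ} {p : ℝ} (hp : 0 < p) :
    rZero n p ^ 2 = p * (n + 1) / (p * (n + 1) + 2 * (n : ℝ) ^ 2) :=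
  Real.sq_sqrt (by positivity)

theorem one_sub_rZero_sq {n : ℕ} {p : ℝ} (hp : 0 < p) :
    1 - rZero n p ^ 2 = 2 * (n : ℝ) ^ 2 / (p * (n + 1) + 2 * (n : ℝ) ^ 2) := by
  rw [rZero_sq hp]
  field_simp
  ring

theorem isMaxOn_rhoOne {n : ℕ} (hn : 1 ≤ n) {p K₀ lam₀ : ℝ} (hp : 0 < p) (hK : 0 < K₀)
    (hlam : 0 < lam₀) : IsMaxOn (rhoOne n p K₀ lam₀) (Ioo (0 : ℝ) 1) (rZero n p) := by
  intro r hr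
  have hn' : (0 : ℝ) < n := by exact_mod_cast hn
  have hm := landauM_pos
  have hr0 := rZero_mem_Ioo hn hp
  have hpow : ∀ x : ℝ, 0 < x → x ^ (n + 1) = (x ^ 2) ^ (((n : ℝ) + 1) / 2) := by
    intro x hx
    rw [← Real.rpow_two, ← Real.rpow_mul hx.le, mul_div_cancel₀ _ two_ne_zero]
    exact_mod_cast (Real.rpow_natCast x (n + 1)).symm
  have hx : rZero n p ^ 2 = ((n + 1) / 2) / ((n + 1) / 2 + (n : ℝ) ^ 2 / p) := by
    rw [rZero_sq hp]
    field_simp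
  have hcoef : 0 ≤ lam₀ / (landauM * K₀ ^ n) := by positivity
  refine mul_le_mul_of_nonneg_left ?_ hcoef
  rw [hpow r hr.1, hpow _ hr0.1, hx]
  exact rpow_mul_one_sub_rpow_le (by positivity) (by positivity) (pow_pos hr.1 2)
    (pow_lt_one₀ hr.1.le hr.2 two_ne_zero)

/-! ### Landau's theorem -/

theorem det_complexJacobian {n : ℕ} (f : Cn n → Cn n) (z : Cn n) :
    (complexJacobian f z).det = LinearMap.det (fderiv ℂ f z : Cn n →ₗ[ℂ] Cn n) := by
  rw [← LinearMap.det_toMatrix (EuclideanSpace.basisFun (Fin n) ℂ).toBasis]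
  rfl

/-- The derivative estimates for a bounded holomorphic map, transferred from the unit ball by
scaling. -/
theorem univalentOn_and_containsUnivalentBall_of_bounded {n : ℕ} (hn : 1 ≤ n) {f : Cn n → Cn n}
    {r M lam : ℝ} (hr : 0 < r) (hM : 0 < M) (hlam : 0 < lam)
    (hf : DifferentiableOn ℂ f (ball 0 r)) (hfM : ∀ z ∈ ball (0 : Cn n) r, ‖f z‖ ≤ M)
    (hf0 : f 0 = 0) (hdet : ‖LinearMap.det (fderiv ℂ f 0 : Cn n →ₗ[ℂ] Cn n)‖ = lam) :
    lam * r ^ (n + 1) / (landauM * M ^ n) < r ∧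
    UnivalentOn f (ball 0 (lam * r ^ (n + 1) / (landauM * M ^ n))) ∧
    ContainsUnivalentBall f (ball 0 (lam * r ^ (n + 1) / (landauM * M ^ n))) 0
      (lam ^ 2 * r ^ (2 * n) / (2 * landauM * M ^ (2 * n - 1))) := by
  obtain ⟨hs0, hs1, hsm, hms⟩ := schwarzRadius_spec
  have hm := landauM_pos
  set F : Cn n → Cn n := fun z => ((M⁻¹ : ℝ) : ℂ) • f ((r : ℂ) • z) with hF
  have hmaps : MapsTo (fun z : Cn n => (r : ℂ) • z) (ball 0 1) (ball 0 r) := by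
    intro z hz
    rw [mem_ball_zero_iff] at hz ⊢
    rw [norm_smul, Complex.norm_real, Real.norm_of_nonneg hr.le]
    exact mul_lt_of_lt_one_right hr hz
  have hFd : DifferentiableOn ℂ F (ball 0 1) := by
    have h : DifferentiableOn ℂ (fun z => f ((r : ℂ) • z)) (ball 0 1) :=
      hf.comp (by fun_prop) hmaps
    exact h.const_smul ((M⁻¹ : ℝ) : ℂ)
  have hF1 : ∀ z ∈ ball (0 : Cn n) 1, ‖F z‖ ≤ 1 := by
    intro z hz
    simp only [hF]
    rw [norm_smul, Complex.norm_real, Real.norm_of_nonneg (by positivity), inv_mul_le_one₀ hM]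
    exact hfM _ (hmaps hz)
  have hF0 : F 0 = 0 := by simp [hF, hf0]
  have hFf : ∀ z ∈ ball (0 : Cn n) 1,
      fderiv ℂ F z = ((r / M : ℝ) : ℂ) • fderiv ℂ f ((r : ℂ) • z) := by
    intro z hz
    have h1 : HasFDerivAt (fun z : Cn n => (r : ℂ) • z) ((r : ℂ) • ContinuousLinearMap.id ℂ (Cn n)) z :=
      (hasFDerivAt_id z).const_smul (r : ℂ)
    have h2 := ((hf.differentiableAt (isOpen_ball.mem_nhds (hmaps hz))).hasFDerivAt.comp z
      h1).const_smul ((M⁻¹ : ℝ) : ℂ)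
    refine h2.fderiv.trans ?_
    ext1 v
    simp only [smul_apply, ContinuousLinearMap.comp_apply, ContinuousLinearMap.id_apply, map_smul,
      smul_smul]
    congr 1
    push_cast
    ring
  have hFf0 : fderiv ℂ F 0 = ((r / M : ℝ) : ℂ) • fderiv ℂ f 0 := by
    simpa using hFf 0 (mem_ball_self one_pos)
  have hrM : ‖((r / M : ℝ) : ℂ)‖ = r / M := by
    rw [Complex.norm_real, Real.norm_of_nonneg (by positivity)]
  set α : ℝ := (r / M) ^ n * lam with hα
  have hαpos : 0 < α := by positivity
  have hFdet : ‖LinearMap.det (fderiv ℂ F 0 : Cn n →ₗ[ℂ] Cn n)‖ = α := by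
    rw [hFf0, ContinuousLinearMap.toLinearMap_smul, LinearMap.det_smul, norm_mul, norm_pow, hrM,
      hdet, finrank_euclideanSpace_fin]
  have hF0norm : ‖fderiv ℂ F 0‖ ≤ 1 := by
    simpa using norm_fderiv_le_of_norm_le_one hFd hF1 (mem_ball_self one_pos)
  have hexp := norm_det_mul_norm_le (fderiv ℂ F 0) hF0norm
  rw [hFdet] at hexp
  have hα1 : α ≤ 1 := by
    have h1 := hexp (EuclideanSpace.single ⟨0, hn⟩ 1)
    have h2 := (fderiv ℂ F 0).le_of_opNorm_le hF0norm (EuclideanSpace.single ⟨0, hn⟩ 1)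
    simp only [PiLp.norm_single, norm_one, mul_one] at h1 h2
    exact h1.trans h2
  set a : ℝ := M / r * α with ha
  set c : ℝ := M * landauM / r ^ 2 with hc
  have hapos : 0 < a := by positivity
  have hcpos : 0 < c := by positivity
  have hac : a / c = r * α / landauM := by rw [ha, hc]; field_simp
  -- the Schwarz estimate, rescaled by `r`, is available on the ball of radius `r * schwarzRadius`
  have hacs : a / c < r * schwarzRadius := by
    rw [hac, div_lt_iff₀ hm]
    nlinarith
  have hacr : a / c < r := hacs.trans (mul_lt_of_lt_one_right hr hs1)
  have hA : ∀ v, a * ‖v‖ ≤ ‖fderiv ℂ f 0 v‖ := by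
    intro v
    have h := hexp v
    rw [hFf0, smul_apply, norm_smul, hrM] at h
    calc a * ‖v‖ = M / r * (α * ‖v‖) := by rw [ha]; ring
      _ ≤ M / r * (r / M * ‖fderiv ℂ f 0 v‖) := by gcongr
      _ = ‖fderiv ℂ f 0 v‖ := by field_simp
  have hfd : DifferentiableOn ℂ f (ball 0 (a / c)) := hf.mono (ball_subset_ball hacr.le)
  have hfc : ∀ z ∈ ball (0 : Cn n) (a / c), ‖fderiv ℂ f z - fderiv ℂ f 0‖ ≤ c * ‖z‖ := by
    intro z hz
    set w : Cn n := ((r⁻¹ : ℝ) : ℂ) • z with hw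
    have hrw : (r : ℂ) • w = z := by
      rw [hw, smul_smul, ← Complex.ofReal_mul, mul_inv_cancel₀ hr.ne', Complex.ofReal_one, one_smul]
    have hwn : ‖w‖ = r⁻¹ * ‖z‖ := by
      rw [hw, norm_smul, Complex.norm_real, Real.norm_of_nonneg (by positivity)]
    have hws : ‖w‖ < schwarzRadius := by
      rw [hwn, inv_mul_lt_iff₀ hr]
      exact (mem_ball_zero_iff.1 hz).trans hacs
    have h := norm_fderiv_sub_le hFd hF1 hF0 hs1 hws
    rw [hsm, hFf w (mem_ball_zero_iff.2 (hws.trans hs1)), hFf0, hrw,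
      ← smul_sub ((r / M : ℝ) : ℂ) (fderiv ℂ f z), norm_smul, hrM, hwn] at h
    calc ‖fderiv ℂ f z - fderiv ℂ f 0‖
        = M / r * (r / M * ‖fderiv ℂ f z - fderiv ℂ f 0‖) := by field_simp
      _ ≤ M / r * (landauM * (r⁻¹ * ‖z‖)) := by gcongr
      _ = c * ‖z‖ := by rw [hc]; field_simp
  have hρ : lam * r ^ (n + 1) / (landauM * M ^ n) = a / c := by
    rw [hac, hα, div_pow, pow_succ]
    field_simp
  have hR : lam ^ 2 * r ^ (2 * n) / (2 * landauM * M ^ (2 * n - 1)) = a ^ 2 / (2 * c) := by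
    have h2n : M ^ (2 * n) = M ^ (2 * n - 1) * M := by rw [← pow_succ]; congr 1; omega
    have hα2 : α ^ 2 = r ^ (2 * n) * lam ^ 2 / (M ^ (2 * n - 1) * M) := by
      rw [hα, div_pow, ← h2n]
      field_simp
      ring
    rw [ha, hc, mul_pow, hα2]
    field_simp
  rw [hρ, hR]
  exact ⟨hacr, ⟨hfd, injOn_of_fderiv_sub_le hapos hcpos hA hfd hfc⟩,
    containsUnivalentBall_of_fderiv_sub_le hapos hcpos hf0 hA hfd hfc⟩

theorem theorem3 (n : ℕ) (hn : 1 ≤ n) (p : ℝ) (hp : 0 < p) (K₀ lam₀ : ℝ)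
    (hK : 0 < K₀) (hlam : 0 < lam₀) (hKlam : lam₀ ≤ K₀)
    (f : Cn n → Cn n) (hf : MemHardy p f) (hfK : hardyNorm p f ≤ ENNReal.ofReal K₀)
    (hf0 : f 0 = 0) (hdet : ‖(complexJacobian f 0).det‖ = lam₀) :
    |landauM - 4.1996| < 0.0001 ∧
    rZero n p ∈ Ioo (0 : ℝ) 1 ∧
    IsMaxOn (rhoOne n p K₀ lam₀) (Ioo (0 : ℝ) 1) (rZero n p) ∧
    ball (0 : Cn n) (rhoOne n p K₀ lam₀ (rZero n p)) ⊆ ball 0 1 ∧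
    UnivalentOn f (ball 0 (rhoOne n p K₀ lam₀ (rZero n p))) ∧
    ContainsUnivalentBall f (ball 0 (rhoOne n p K₀ lam₀ (rZero n p))) 0
      (landauR n p K₀ lam₀) := by
  have hr0 := rZero_mem_Ioo hn hp
  set r := rZero n p with hr
  have hq : 0 < 1 - r ^ 2 := by nlinarith [hr0.1, hr0.2]
  set M : ℝ := K₀ * (1 - r ^ 2) ^ (-(n / p)) with hM
  have hMpos : 0 < M := by positivity
  have hfd : DifferentiableOn ℂ f (ball 0 r) := hf.1.mono (ball_subset_ball hr0.2.le)
  have hfM : ∀ z ∈ ball (0 : Cn n) r, ‖f z‖ ≤ M := by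
    intro z hz
    have hz1 : ‖z‖ < r := mem_ball_zero_iff.1 hz
    refine (norm_le_of_hardyNorm_le hn hp hf.1 hK.le hfK (ball_subset_ball hr0.2.le hz)).trans
      (mul_le_mul_of_nonneg_left ?_ hK.le)
    refine Real.rpow_le_rpow_of_nonpos hq ?_ (neg_nonpos.2 (by positivity))
    nlinarith [norm_nonneg z]
  rw [det_complexJacobian] at hdet
  obtain ⟨hlt, huniv, hball⟩ := univalentOn_and_containsUnivalentBall_of_bounded hn hr0.1 hMpos
    hlam hfd hfM hf0 hdet
  have hm := landauM_pos
  have hMpow : ∀ k : ℕ, M ^ k = K₀ ^ k / (1 - r ^ 2) ^ (n * k / p : ℝ) := by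
    intro k
    rw [hM, mul_pow, ← Real.rpow_mul_natCast hq.le, neg_mul, Real.rpow_neg hq.le,
      ← div_eq_mul_inv, div_mul_eq_mul_div]
  have hρ : lam₀ * r ^ (n + 1) / (landauM * M ^ n) = rhoOne n p K₀ lam₀ r := by
    rw [hMpow, rhoOne, ← sq]
    have := Real.rpow_pos_of_pos hq ((n : ℝ) ^ 2 / p)
    field_simp
  have hR : lam₀ ^ 2 * r ^ (2 * n) / (2 * landauM * M ^ (2 * n - 1)) = landauR n p K₀ lam₀ := by
    have he : (n * ((2 * n - 1 : ℕ) : ℝ) / p : ℝ) = (2 * (n : ℝ) ^ 2 - n) / p := by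
      rw [Nat.cast_sub (by omega)]
      push_cast
      ring
    rw [hMpow, landauR, he, ← rZero_sq hp, ← one_sub_rZero_sq hp, ← hr, ← pow_mul]
    have := Real.rpow_pos_of_pos hq ((2 * (n : ℝ) ^ 2 - n) / p)
    field_simp
  rw [hρ] at hlt huniv hball
  rw [hR] at hball
  exact ⟨abs_landauM_sub_lt, hr0, isMaxOn_rhoOne hn hp hK hlam,
    ball_subset_ball (hlt.trans hr0.2).le, huniv, hball⟩
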